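/- **Setting.** Let $G(N_1\cup N_2,E)$ be a bipartite graph with $n$ server types $i$ and $m$ customer types $j$. For each $j$ let $F_j$ be a demand curve (arrival rate $\mapsto$ price) and for each $i$ let $G_i$ be a supply curve, defined on intervals $\mathrm{dom}(F_j),\mathrm{dom}(G_i)\subseteq[0,\infty)$ (for example $[0,\infty)$). Assume that $F_j$ is strictly decreasing, $G_i$ is strictly increasing, all are twice continuously differentiable, $\lambda\mapsto\lambda F_j(\lambda)$ is concave and $\mu\mapsto\mu G_i(\mu)$ is convex. Let $s\ge 0$ be the holding cost. The fluid problem is to maximize $\sum_j F_j(\lambda_j)\lambda_j-\sum_i G_i(\mu_i)\mu_i$ over $\lambda_j\in\mathrm{dom}(F_j)$, $\mu_i\in\mathrm{dom}(G_i)$ and $\chi\in\mathbb{R}^{n\times m}$ subject to $\lambda_j=\sum_i\chi_{ij}$, $\mu_i=\sum_j\chi_{ij}$, $\chi_{ij}\ge 0$ for $(i,j)\in E$ and $\chi_{ij}=0$ for $(i,j)\notin E$. Let $(\lambda^*,\mu^*,\chi^*)$ be an optimal solution such that each nonzero $\lambda_j^*$ and $\mu_i^*$ is an interior point of the domain of its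 curve (which is automatic if the domains are $[0,\infty)$), and let $E^*=\{(i,j)\in E:\chi^*_{ij}>0\}$. **The $\eta$-th system.** For $\eta\in\mathbb{N}$ the $\eta$-th system has the same graph and holding cost and the curves $F_j^\eta(\eta\lambda)=F_j(\lambda)$, $G_i^\eta(\eta\mu)=G_i(\mu)$; let $\pi_*^\eta$ be the optimal value of its fluid problem. Fix constants $T_1>0$, $\theta_j>0$, $\phi_i>0$. When $q^{(1)}_i$ servers of type $i$ and $q^{(2)}_j$ customers of type $j$ are waiting, the two-price policy uses the Poisson arrival rates $$\lambda_j^\eta(q)=\begin{cases}\eta\lambda_j^*&\text{if }q_j^{(2)}\le T_1\eta^{1/3},\\ \eta\lambda_j^*-\theta_j\eta^{2/3}&\text{otherwise,}\end{cases}\qquad \mu_i^\eta(q)=\begin{cases}\eta\mu_i^*&\text{if }q_i^{(1)}\le T_1\eta^{1/3},\\ \eta\mu_i^*-\phi_i\eta^{2/3}&\text{otherwise,}\end{cases}$$ where negative values are replaced by $0$. Modified max-weight matching matches each arrival at once to a longest nonempty queue among the types compatible with it along $E^*$ (ties are broken by an arbitrary function of the state and the arrival), and lets it wait in its own queue if all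 those queues are empty. The system starts empty. **Theorem.** For all sufficiently large $\eta$: * in every state that the system can reach, the above formulas for the rates are nonnegative and the rates lie in the domains of $F_j^\eta$ and $G_i^\eta$; * the system is stable, that is, the empty state is positive recurrent for the queue length process $q(t)$, a continuous-time Markov chain; * the long-run average profit $$\lim_{T\to\infty}\frac1T\int_0^T\mathbb{E}\Bigl[\sum_j F^\eta_j(\lambda_j^\eta(q(t)))\lambda_j^\eta(q(t))-\sum_i G^\eta_i(\mu_i^\eta(q(t)))\mu_i^\eta(q(t))-s\Bigl(\sum_i q^{(1)}_i(t)+\sum_j q^{(2)}_j(t)\Bigr)\Bigr]\,dt$$ exists. The profit loss $L^\eta$, defined as $\pi_*^\eta$ minus this long-run average profit, satisfies $L^\eta=O(\eta^{1/3})$ as $\eta\to\infty$. -/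

import Mathlib

open Filter Asymptotics Topology
open scoped NNReal ENNReal

/-- Data of a two-sided queueing system with `n` server types and `m` customer types:
the compatibility edges, the demand curves `F j` (arrival rate ↦ price) and the supply curves `G i`
with their domains, and the holding cost `s` per waiting customer or server and unit of time. -/
structure TwoSidedQueue (n m : ℕ) where
  edges : Set (Fin n × Fin m)
  F : Fin m → ℝ → ℝ
  domF : Fin m → Set ℝ
  G : Fin n → ℝ → ℝ
  domG : Fin n → Set ℝ
  s : ℝ

/-- Queue lengths: `q.1 i` servers of type `i` and `q.2 j` customers of type `j` are waiting. -/
abbrev QueueState (n m : ℕ) : Type := (Fin n → ℕ) × (Fin m → ℕ)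

/-- A point `(λ, μ, χ)` of the fluid problem. -/
structure FluidPoint (n m : ℕ) where
  lam : Fin m → ℝ
  mu : Fin n → ℝ
  chi : Fin n → Fin m → ℝ

namespace TwoSidedQueue

variable {n m : ℕ}

/-- Standing assumptions on the curves: the domains are intervals of nonnegative rates (for example
`[0, ∞)`); demand curves are strictly decreasing and `C²` with concave revenue `x * F j x`; supply
curves are strictly increasing and `C²` with convex cost `x * G i x`; the holding cost is
nonnegative. -/
structure Regular (M : TwoSidedQueue n m) : Prop where
  domF_nonneg : ∀ j, M.domF j ⊆ Set.Ici 0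
  domG_nonneg : ∀ i, M.domG i ⊆ Set.Ici 0
  F_strictAnti : ∀ j, StrictAntiOn (M.F j) (M.domF j)
  F_smooth : ∀ j, ContDiffOn ℝ 2 (M.F j) (M.domF j)
  G_strictMono : ∀ i, StrictMonoOn (M.G i) (M.domG i)
  G_smooth : ∀ i, ContDiffOn ℝ 2 (M.G i) (M.domG i)
  revenue_concave : ∀ j, ConcaveOn ℝ (M.domF j) (fun x => x * M.F j x)
  cost_convex : ∀ i, ConvexOn ℝ (M.domG i) (fun x => x * M.G i x)
  s_nonneg : 0 ≤ M.s

/-- The `η`-th system of the asymptotic regime: same graph and holding cost, and curves with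
`F^η (η x) = F x` and `G^η (η x) = G x`. -/
noncomputable def scaled (M : TwoSidedQueue n m) (η : ℕ) : TwoSidedQueue n m where
  edges := M.edges
  F := fun j x => M.F j (x / η)
  domF := fun j => {x | x / η ∈ M.domF j}
  G := fun i x => M.G i (x / η)
  domG := fun i => {x | x / η ∈ M.domG i}
  s := M.s

/-! ### The fluid problem -/

def fluidObjective (M : TwoSidedQueue n m) (x : FluidPoint n m) : ℝ :=
  ∑ j, M.F j (x.lam j) * x.lam j - ∑ i, M.G i (x.mu i) * x.mu i

/-- Feasibility for the fluid problem: admissible rates, balance equations, and matching rates that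
are nonnegative and vanish off the edges. -/
structure FluidFeasible (M : TwoSidedQueue n m) (x : FluidPoint n m) : Prop where
  lam_mem : ∀ j, x.lam j ∈ M.domF j
  mu_mem : ∀ i, x.mu i ∈ M.domG i
  lam_eq : ∀ j, x.lam j = ∑ i, x.chi i j
  mu_eq : ∀ i, x.mu i = ∑ j, x.chi i j
  chi_zero : ∀ i j, (i, j) ∉ M.edges → x.chi i j = 0
  chi_nonneg : ∀ i j, (i, j) ∈ M.edges → 0 ≤ x.chi i j

def FluidOptimal (M : TwoSidedQueue n m) (x : FluidPoint n m) : Prop :=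
  M.FluidFeasible x ∧ ∀ y, M.FluidFeasible y → M.fluidObjective y ≤ M.fluidObjective x

/-- The optimal value of the fluid problem. -/
noncomputable def fluidValue (M : TwoSidedQueue n m) : ℝ :=
  sSup (M.fluidObjective '' {x | M.FluidFeasible x})

/-- The support `E*` of the matching rates of a fluid point. -/
def fluidSupport (M : TwoSidedQueue n m) (x : FluidPoint n m) : Set (Fin n × Fin m) :=
  {e | e ∈ M.edges ∧ 0 < x.chi e.1 e.2}

end TwoSidedQueue

/-! ### Policies -/

/-- A pricing policy, given by the state-dependent Poisson arrival rates that its prices induce,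
with a positive bound `cap` on the total arrival rate. -/
structure ArrivalRates (n m : ℕ) where
  customer : QueueState n m → Fin m → ℝ≥0
  server : QueueState n m → Fin n → ℝ≥0
  cap : ℝ≥0
  cap_pos : 0 < cap
  total_le : ∀ q, ∑ i, server q i + ∑ j, customer q j ≤ cap

/-- A policy that matches upon arrivals: for each state just before an arrival and each type of the
arriving server (customer), the type of the waiting customer (server) it is matched to, if any. -/
structure MatchingRule (n m : ℕ) where
  onServer : QueueState n m → Fin n → Option (Fin m)
  onCustomer : QueueState n m → Fin m → Option (Fin n)

/-- The rule is max-weight matching along the edges in `E`: an arrival is matched to a longest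
nonempty compatible queue, with ties broken arbitrarily, and joins its own queue if all compatible
queues are empty. -/
structure MatchingRule.IsMaxWeight {n m : ℕ} (r : MatchingRule n m) (E : Set (Fin n × Fin m)) :
    Prop where
  onServer_some : ∀ q i j, r.onServer q i = some j →
    (i, j) ∈ E ∧ 0 < q.2 j ∧ ∀ j', (i, j') ∈ E → q.2 j' ≤ q.2 j
  onServer_none : ∀ q i, r.onServer q i = none → ∀ j, (i, j) ∈ E → q.2 j = 0
  onCustomer_some : ∀ q j i, r.onCustomer q j = some i →
    (i, j) ∈ E ∧ 0 < q.1 i ∧ ∀ i', (i', j) ∈ E → q.1 i' ≤ q.1 i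
  onCustomer_none : ∀ q j, r.onCustomer q j = none → ∀ i, (i, j) ∈ E → q.1 i = 0

/-- The state after an event: the arrival of a server or of a customer, or no arrival. -/
def MatchingRule.next {n m : ℕ} (r : MatchingRule n m) (q : QueueState n m) :
    Option (Fin n ⊕ Fin m) → QueueState n m
  | none => q
  | some (Sum.inl i) =>
    match r.onServer q i with
    | some j => (q.1, Function.update q.2 j (q.2 j - 1))
    | none => (Function.update q.1 i (q.1 i + 1), q.2)
  | some (Sum.inr j) =>
    match r.onCustomer q j with
    | some i => (Function.update q.1 i (q.1 i - 1), q.2)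
    | none => (q.1, Function.update q.2 j (q.2 j + 1))

/-! ### The induced continuous-time Markov chain

The chain jumps from `q` to `r.next q e` at the rate of the arrival `e` in state `q`. All rates are
bounded by `cap`, and the chain is built by uniformization: candidate events occur at the times of
a Poisson process of rate `cap`, and at each of them the state makes a step of the discrete chain in
which the arrival `e` has probability (rate of `e`) / `cap`. -/

namespace ArrivalRates

variable {n m : ℕ}

/-- The probabilities of the events at one step of the uniformized chain. -/
noncomputable def eventProb (a : ArrivalRates n m) (q : QueueState n m) :
    Option (Fin n ⊕ Fin m) → ℝ≥0
  | none => 1 - (∑ i, a.server q i + ∑ j, a.customer q j) / a.cap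
  | some (Sum.inl i) => a.server q i / a.cap
  | some (Sum.inr j) => a.customer q j / a.cap

theorem sum_eventProb (a : ArrivalRates n m) (q : QueueState n m) :
    ∑ e, (a.eventProb q e : ℝ≥0∞) = 1 := by
  have h : ∑ e, a.eventProb q e = 1 := by
    rw [Fintype.sum_option, Fintype.sum_sum_type]
    simp only [eventProb]
    rw [← Finset.sum_div, ← Finset.sum_div, ← add_div]
    exact tsub_add_cancel_of_le ((div_le_one a.cap_pos).2 (a.total_le q))
  exact_mod_cast congrArg ((↑) : ℝ≥0 → ℝ≥0∞) h

/-- One step of the uniformized chain. -/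
noncomputable def step (a : ArrivalRates n m) (r : MatchingRule n m) (q : QueueState n m) :
    PMF (QueueState n m) :=
  (PMF.ofFintype (fun e => (a.eventProb q e : ℝ≥0∞)) (a.sum_eventProb q)).map (r.next q)

/-- The law of the uniformized chain after `k` steps, started with empty queues. -/
noncomputable def chain (a : ArrivalRates n m) (r : MatchingRule n m) : ℕ → PMF (QueueState n m)
  | 0 => PMF.pure 0
  | k + 1 => (chain a r k).bind (a.step r)

/-- The law of the continuous-time chain at time `t`, started with empty queues. -/
noncomputable def law (a : ArrivalRates n m) (r : MatchingRule n m) (t : ℝ≥0) :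
    PMF (QueueState n m) :=
  (ProbabilityTheory.poissonMeasure (a.cap * t)).toPMF.bind (a.chain r)

/-- A state that has positive probability at some time, started with empty queues. -/
def Reachable (a : ArrivalRates n m) (r : MatchingRule n m) (q : QueueState n m) : Prop :=
  ∃ k, q ∈ (a.chain r k).support

/-- The probability that the uniformized chain started in `q` avoids the empty state at each of
the steps `1, …, k`. -/
noncomputable def avoidProb (a : ArrivalRates n m) (r : MatchingRule n m) :
    ℕ → QueueState n m → ℝ≥0∞
  | 0, _ => 1
  | k + 1, q => ∑' q', a.step r q q' * (if q' = 0 then 0 else avoidProb a r k q')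

/-- Stability: the empty state, hence its communicating class, is positive recurrent, that is, the
expected return time to it is finite. The expected number of steps until the return is
`∑ k, P(no return in the first k steps)`, and a step takes an expected time of `1 / cap`. -/
def Stable (a : ArrivalRates n m) (r : MatchingRule n m) : Prop :=
  (a.cap : ℝ≥0∞)⁻¹ * ∑' k, a.avoidProb r k 0 ≠ ∞

/-- `g` is the long-run average, in expectation, of the rate function `R` along the chain started
with empty queues: `(1/T) ∫₀ᵀ E[R(q(t))] dt → g`, where all the expectations and integrals exist. -/
def HasLongRunAverage (a : ArrivalRates n m) (r : MatchingRule n m)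
    (R : QueueState n m → ℝ) (g : ℝ) : Prop :=
  (∀ t : ℝ≥0, Summable fun q => (a.law r t q).toReal * R q) ∧
  (∀ T : ℝ, 0 ≤ T → IntervalIntegrable
    (fun t : ℝ => ∑' q, (a.law r t.toNNReal q).toReal * R q) MeasureTheory.volume 0 T) ∧
  Tendsto (fun T : ℝ => T⁻¹ * ∫ t in (0 : ℝ)..T, ∑' q, (a.law r t.toNNReal q).toReal * R q)
    atTop (𝓝 g)

end ArrivalRates

namespace TwoSidedQueue

variable {n m : ℕ}

/-- The expected profit per unit of time in state `q`: revenue from customers minus payments to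
servers, minus the holding cost. -/
noncomputable def profitRate (M : TwoSidedQueue n m) (a : ArrivalRates n m)
    (q : QueueState n m) : ℝ :=
  ∑ j, M.F j (a.customer q j) * a.customer q j - ∑ i, M.G i (a.server q i) * a.server q i
    - M.s * (∑ i, (q.1 i : ℝ) + ∑ j, (q.2 j : ℝ))

/-- The pricing policy uses, in all states that occur, rates in the domains of the curves. -/
def Admissible (M : TwoSidedQueue n m) (a : ArrivalRates n m) (r : MatchingRule n m) : Prop :=
  ∀ q, a.Reachable r q →
    (∀ j, (a.customer q j : ℝ) ∈ M.domF j) ∧ (∀ i, (a.server q i : ℝ) ∈ M.domG i)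

/-- `L` is the profit loss of a policy: the optimal value of the fluid problem minus the long-run
average profit of the policy. -/
def HasProfitLoss (M : TwoSidedQueue n m) (a : ArrivalRates n m) (r : MatchingRule n m)
    (L : ℝ) : Prop :=
  ∃ g, a.HasLongRunAverage r (M.profitRate a) g ∧ L = M.fluidValue - g

end TwoSidedQueue

/-! ### The two-price policy -/

/-- The rate `η x` while the queue length is at most the threshold `T₁ η^(1/3)`, and
`η x - d η^(2/3)` above it. -/
noncomputable def twoPriceRate (T₁ : ℝ) (η : ℕ) (x : ℝ) (d : ℝ) (len : ℕ) : ℝ :=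
  if (len : ℝ) ≤ T₁ * (η : ℝ) ^ (1 / 3 : ℝ) then η * x else η * x - d * (η : ℝ) ^ (2 / 3 : ℝ)

theorem toNNReal_twoPriceRate_le (T₁ : ℝ) (η : ℕ) (x : ℝ) (d : ℝ≥0) (len : ℕ) :
    (twoPriceRate T₁ η x d len).toNNReal ≤ (η * x).toNNReal := by
  apply Real.toNNReal_le_toNNReal
  unfold twoPriceRate
  split_ifs
  · exact le_rfl
  · have : 0 ≤ (d : ℝ) * (η : ℝ) ^ (2 / 3 : ℝ) := by positivity
    linarith

/-- The two-price policy around the rates of the fluid point `x`. A negative value of the formula is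
replaced by the rate `0`. -/
noncomputable def twoPricePolicy {n m : ℕ} (x : FluidPoint n m) (T₁ : ℝ) (θ : Fin m → ℝ≥0)
    (φ : Fin n → ℝ≥0) (η : ℕ) : ArrivalRates n m where
  customer := fun q j => (twoPriceRate T₁ η (x.lam j) (θ j) (q.2 j)).toNNReal
  server := fun q i => (twoPriceRate T₁ η (x.mu i) (φ i) (q.1 i)).toNNReal
  cap := 1 + (∑ i, ((η : ℝ) * x.mu i).toNNReal + ∑ j, ((η : ℝ) * x.lam j).toNNReal)
  cap_pos := by positivity
  total_le := fun q => le_trans (add_le_add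
    (Finset.sum_le_sum fun _ _ => toNNReal_twoPriceRate_le _ _ _ _ _)
    (Finset.sum_le_sum fun _ _ => toNNReal_twoPriceRate_le _ _ _ _ _)) le_add_self

/-- In all states that occur, the formula of the two-price policy is nonnegative, so that no rate
is changed by the replacement of negative values. -/
def TwoPriceUntruncated {n m : ℕ} (x : FluidPoint n m) (T₁ : ℝ) (θ : Fin m → ℝ≥0)
    (φ : Fin n → ℝ≥0) (η : ℕ) (r : MatchingRule n m) : Prop :=
  ∀ q, (twoPricePolicy x T₁ θ φ η).Reachable r q →
    (∀ j, 0 ≤ twoPriceRate T₁ η (x.lam j) (θ j) (q.2 j)) ∧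
    (∀ i, 0 ≤ twoPriceRate T₁ η (x.mu i) (φ i) (q.1 i))

/-!
The proof rests on two functions of the queue lengths `q` and on the invariant that two types
compatible along `E*` are never both waiting.

**Queue lengths.** Under max-weight matching the sum of squares `QueueState.sumSq` has drift at most
`C η - c η^(2/3) |q|`, where `|q|` is the total queue length: at the full rates, arrivals of compatible
types shorten the longest queues at least as fast as the fluid flow `χ` would shorten all of them, which
balances the arrivals to these queues; above the threshold the reduced rates leave a deficit of order
`η^(2/3)` per unit of queue length (`TwoSidedQueue.cap_mul_op_sumSq_sub_le`). Hence the limiting mean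
of `|q|` is `O(η^(1/3))` (`EventChain.Drift.limit_size_le`).

**Profit.** Expanding revenue and cost to second order around the fluid rates gives an error
`η * (η^(-1/3))^2 = η^(1/3)` (`exists_twoPriceRate_expansion`) and first-order terms of size `η^(2/3)`.
By optimality of the fluid solution, marginal revenue and marginal cost agree along every edge of `E*`
(`TwoSidedQueue.FluidOptimal.deriv_eq`). With these marginals as weights, every arrival of a given type
changes `QueueState.imbalance` by the same amount, matched or not, so the first-order terms are exactly
the drift of this function (`TwoSidedQueue.abs_profitRate_sub_le`) and vanish in the long run.

**Existence of limits.** From every matched state but the empty one, some queue is shortened with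
positive probability, so `sumSq` can be corrected to a Lyapunov function with negative drift everywhere
outside the empty state (`EventChain.exists_lyapunov`). This gives positive recurrence
(`ArrivalRates.stable_of_drift`). Applied to two independent copies of the chain, which are lazy and
therefore can meet at the empty state, it bounds the sum over all steps of the differences between the
expectations from two starting points. So the expectations of all functions of linear growth converge
along the uniformized chain (`EventChain.Drift.exists_tendsto`), without recourse to a stationary
distribution, and so do their Poisson mixtures and time averages.
-/

/-! ### Markov chains driven by finitely many events -/

/-- A Markov chain that in state `z` experiences exactly one of finitely many events `e`, with
probability `prob z e`, and then moves to `next z e`. -/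
structure EventChain (Z E : Type*) [Fintype E] where
  prob : Z → E → ℝ
  next : Z → E → Z
  prob_nonneg : ∀ z e, 0 ≤ prob z e
  sum_prob : ∀ z, ∑ e, prob z e = 1

namespace EventChain

variable {Z W E E' : Type*} [Fintype E] [Fintype E']

/-- The transition operator on functions: `K.op f z` is the expectation of `f` after one step from
`z`. It is a finite sum, so no integrability is needed. -/
def op (K : EventChain Z E) : Module.End ℝ (Z → ℝ) where
  toFun f z := ∑ e, K.prob z e * f (K.next z e)
  map_add' f g := by
    ext z
    simp [mul_add, Finset.sum_add_distrib]
  map_smul' a f := by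
    ext z
    simp only [Pi.smul_apply, smul_eq_mul, RingHom.id_apply, Finset.mul_sum]
    exact Finset.sum_congr rfl fun e _ => by ring

theorem op_apply (K : EventChain Z E) (f : Z → ℝ) (z : Z) :
    K.op f z = ∑ e, K.prob z e * f (K.next z e) := rfl

theorem op_const (K : EventChain Z E) (a : ℝ) : K.op (fun _ => a) = fun _ => a := by
  ext z
  rw [op_apply, ← Finset.sum_mul, K.sum_prob, one_mul]

theorem op_pow_const (K : EventChain Z E) (a : ℝ) (k : ℕ) :
    (K.op ^ k) (fun _ => a) = fun _ => a := by
  induction k with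
  | zero => rfl
  | succ k ih => rw [pow_succ, Module.End.mul_apply, op_const, ih]

theorem op_sub_self (K : EventChain Z E) (f : Z → ℝ) (z : Z) :
    K.op f z - f z = ∑ e, K.prob z e * (f (K.next z e) - f z) := by
  simp only [mul_sub, Finset.sum_sub_distrib, ← Finset.sum_mul, K.sum_prob, one_mul, op_apply]

/-- The set `S` cannot be left. -/
def Closed (K : EventChain Z E) (S : Set Z) : Prop :=
  ∀ z ∈ S, ∀ e, 0 < K.prob z e → K.next z e ∈ S

theorem op_le_op {K : EventChain Z E} {S : Set Z} (hS : K.Closed S) {f g : Z → ℝ}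
    (h : ∀ z ∈ S, f z ≤ g z) {z : Z} (hz : z ∈ S) : K.op f z ≤ K.op g z := by
  refine Finset.sum_le_sum fun e _ => ?_
  rcases (K.prob_nonneg z e).eq_or_lt with h0 | h0
  · rw [← h0, zero_mul, zero_mul]
  · exact mul_le_mul_of_nonneg_left (h _ (hS z hz e h0)) h0.le

theorem op_pow_le_op_pow {K : EventChain Z E} {S : Set Z} (hS : K.Closed S) {f g : Z → ℝ}
    (h : ∀ z ∈ S, f z ≤ g z) (k : ℕ) : ∀ z ∈ S, (K.op ^ k) f z ≤ (K.op ^ k) g z := by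
  induction k with
  | zero => exact h
  | succ k ih =>
    intro z hz
    rw [pow_succ', Module.End.mul_apply, Module.End.mul_apply]
    exact op_le_op hS ih hz

/-- The two components move independently. -/
def prod (K : EventChain Z E) (K' : EventChain W E') : EventChain (Z × W) (E × E') where
  prob z e := K.prob z.1 e.1 * K'.prob z.2 e.2
  next z e := (K.next z.1 e.1, K'.next z.2 e.2)
  prob_nonneg z e := mul_nonneg (K.prob_nonneg _ _) (K'.prob_nonneg _ _)
  sum_prob z := by
    rw [Fintype.sum_prod_type]
    simp only [← Finset.mul_sum, K.sum_prob, K'.sum_prob, mul_one]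

theorem prod_op_fst (K : EventChain Z E) (K' : EventChain W E') (f : Z → ℝ) (z : Z × W) :
    (K.prod K').op (fun z => f z.1) z = K.op f z.1 := by
  simp only [op_apply, prod, Fintype.sum_prod_type]
  refine Finset.sum_congr rfl fun e _ => ?_
  rw [← Finset.sum_mul, ← Finset.mul_sum, K'.sum_prob, mul_one]

theorem prod_op_snd (K : EventChain Z E) (K' : EventChain W E') (f : W → ℝ) (z : Z × W) :
    (K.prod K').op (fun z => f z.2) z = K'.op f z.2 := by
  simp only [op_apply, prod, Fintype.sum_prod_type_right]
  refine Finset.sum_congr rfl fun e _ => ?_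
  rw [← Finset.sum_mul, ← Finset.sum_mul, K.sum_prob, one_mul]

theorem abs_op_le (K : EventChain Z E) (f : Z → ℝ) (z : Z) : |K.op f z| ≤ K.op (fun z => |f z|) z :=
  (Finset.abs_sum_le_sum_abs _ _).trans
    (Finset.sum_le_sum fun e _ => by rw [abs_mul, abs_of_nonneg (K.prob_nonneg z e)])

/-- The law after `k` steps, tested against indicators, determines the expectation of every
function: only finitely many states are within reach, so the sum converges trivially. -/
theorem hasSum_op_pow_single [DecidableEq Z] (K : EventChain Z E) (f : Z → ℝ) (k : ℕ) (z : Z) :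
    HasSum (fun q => (K.op ^ k) (Pi.single q 1) z * f q) ((K.op ^ k) f z) := by
  induction k generalizing z with
  | zero =>
    have : (fun q => ((K.op ^ 0) (Pi.single q 1) z : ℝ) * f q) = Pi.single z (f z) := by
      ext q
      rcases eq_or_ne q z with rfl | h
      · simp
      · simp [h, h.symm]
    rw [this]
    exact hasSum_pi_single z (f z)
  | succ k ih =>
    have h := hasSum_sum (s := Finset.univ) fun e _ =>
      (ih (K.next z e)).mul_left (K.prob z e)
    simpa only [pow_succ', Module.End.mul_apply, op_apply, Finset.sum_mul, mul_assoc] using h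

/-! ### Lyapunov functions and convergence of expectations -/

/-- A quadratic-type Lyapunov function `V`, whose drift is negative only for large sizes `N z`, can
be corrected to have drift at most `-A (1 + N z)` everywhere but at size zero, provided the size
decreases with a probability at least `p` from every state of positive size. The correction is a
multiple of `1 - (p / 2) ^ N z`: the gain from the downward step beats all upward steps. -/
theorem exists_lyapunov (K : EventChain Z E) {S : Set Z} {N : Z → ℕ} {V : Z → ℝ} {c C p : ℝ}
    (hV : ∀ z, 0 ≤ V z) (hc : 0 < c) (hp : 0 < p) (hp1 : p ≤ 1)
    (hdrift : ∀ z ∈ S, K.op V z ≤ V z + C - c * N z)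
    (hdown : ∀ z ∈ S, 0 < N z → ∃ e, p ≤ K.prob z e ∧ N (K.next z e) < N z)
    {A : ℝ} (hA : 0 < A) :
    ∃ U : Z → ℝ, (∀ z, 0 ≤ U z) ∧
      ∀ z ∈ S, 0 < N z → K.op U z + A * (1 + N z) ≤ U z := by
  set ε := p / 2 with hε
  have hε0 : 0 < ε := by positivity
  have hε1 : ε ≤ 1 := by linarith
  set a := 2 * A / c with ha
  have ha0 : 0 < a := by positivity
  obtain ⟨n₀, hn₀⟩ := exists_nat_ge ((a * C + A) / A)
  set D := |a * C + A| / ε ^ n₀ with hD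
  have hD0 : 0 ≤ D := by positivity
  let B : Z → ℝ := fun z => 1 - ε ^ N z
  refine ⟨a • V + D • B, fun z => ?_, fun z hz hN => ?_⟩
  · have : 0 ≤ B z := sub_nonneg.2 (pow_le_one₀ hε0.le hε1)
    have := hV z
    simp only [Pi.add_apply, Pi.smul_apply, smul_eq_mul]
    positivity
  · have hB : K.op B z ≤ B z - ε ^ N z := by
      obtain ⟨e, he, hlt⟩ := hdown z hz hN
      have h1 : K.op B z = 1 - ∑ e, K.prob z e * ε ^ N (K.next z e) := by
        simp only [op_apply, B, mul_sub, mul_one, Finset.sum_sub_distrib, K.sum_prob]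
      have h2 : K.prob z e * ε ^ N (K.next z e) ≤ ∑ e, K.prob z e * ε ^ N (K.next z e) :=
        Finset.single_le_sum (f := fun e => K.prob z e * ε ^ N (K.next z e))
          (fun e _ => mul_nonneg (K.prob_nonneg z e) (by positivity)) (Finset.mem_univ e)
      have h3 : p * ε ^ (N z - 1) ≤ K.prob z e * ε ^ N (K.next z e) :=
        mul_le_mul he (pow_le_pow_of_le_one hε0.le hε1 (by omega)) (by positivity)
          (K.prob_nonneg z e)
      have h4 : p * ε ^ (N z - 1) = 2 * ε ^ N z := by
        obtain ⟨l, hl⟩ : ∃ l, N z = l + 1 := ⟨N z - 1, by omega⟩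
        rw [hl, Nat.add_sub_cancel, pow_succ, hε]
        ring
      rw [h1]
      simp only [B]
      linarith
    have hkey : a * C + A - A * N z ≤ D * ε ^ N z := by
      rcases le_total n₀ (N z) with h | h
      · have h1 : (n₀ : ℝ) ≤ N z := by exact_mod_cast h
        have h2 : (a * C + A) / A * A ≤ N z * A := by gcongr; linarith
        rw [div_mul_cancel₀ _ hA.ne'] at h2
        have : 0 ≤ D * ε ^ N z := by positivity
        linarith
      · have h1 : ε ^ n₀ ≤ ε ^ N z := pow_le_pow_of_le_one hε0.le hε1 h
        have h2 : D * ε ^ n₀ ≤ D * ε ^ N z := by gcongr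
        rw [hD, div_mul_cancel₀ _ (by positivity)] at h2
        have h3 := le_abs_self (a * C + A)
        have : 0 ≤ A * N z := by positivity
        linarith
    have hV' := mul_le_mul_of_nonneg_left (hdrift z hz) ha0.le
    have hB' := mul_le_mul_of_nonneg_left hB hD0
    have hac : a * (c * N z) = 2 * A * N z := by
      rw [ha]
      field_simp
    rw [map_add, map_smul, map_smul]
    simp only [Pi.add_apply, Pi.smul_apply, smul_eq_mul]
    linarith

/-- The chain restricted to `S` has a linearly negative drift of `V` in the size `N`, the size
decreases with probability at least `p` unless the state is the origin `o`, the only one of size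
zero, and the chain stays put with probability at least `p`. -/
structure Drift (K : EventChain Z E) (S : Set Z) (o : Z) (N : Z → ℕ) (V : Z → ℝ) (c C p : ℝ) :
    Prop where
  closed : K.Closed S
  mem : o ∈ S
  eq_origin : ∀ z ∈ S, N z = 0 → z = o
  nonneg : ∀ z, 0 ≤ V z
  c_pos : 0 < c
  p_pos : 0 < p
  p_le_one : p ≤ 1
  drift : ∀ z ∈ S, K.op V z ≤ V z + C - c * N z
  down : ∀ z ∈ S, 0 < N z → ∃ e, p ≤ K.prob z e ∧ N (K.next z e) < N z
  lazy : ∀ z ∈ S, ∃ e, p ≤ K.prob z e ∧ K.next z e = z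

namespace Drift

variable {K : EventChain Z E} {S : Set Z} {o : Z} {N : Z → ℕ} {V : Z → ℝ} {c C p : ℝ}

/-- Laziness makes the total size of two independent copies decrease with positive probability
whenever it is positive, so that the pair has a Lyapunov function outside `(o, o)`. -/
theorem exists_lyapunov_prod (h : K.Drift S o N V c C p) {A : ℝ} (hA : 0 < A) :
    ∃ D : Z × Z → ℝ, (∀ z, 0 ≤ D z) ∧ ∀ x ∈ S, ∀ y ∈ S, 0 < N x + N y →
      (K.prod K).op D (x, y) + A * (1 + (N x + N y)) ≤ D (x, y) := by
  obtain ⟨D, hD0, hD⟩ := (K.prod K).exists_lyapunov (S := S ×ˢ S) (N := fun z => N z.1 + N z.2)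
    (V := (fun z => V z.1) + fun z => V z.2) (c := c) (C := C + C) (p := p * p)
    (fun z => add_nonneg (h.nonneg _) (h.nonneg _)) h.c_pos (mul_pos h.p_pos h.p_pos)
    (mul_le_one₀ h.p_le_one h.p_pos.le h.p_le_one)
    (fun z hz => by
      rw [map_add, Pi.add_apply, prod_op_fst, prod_op_snd]
      have h1 := h.drift _ hz.1
      have h2 := h.drift _ hz.2
      simp only [Pi.add_apply]
      push_cast
      linarith)
    (fun z hz hN => by
      by_cases h1 : 0 < N z.1
      · obtain ⟨e, he, hlt⟩ := h.down _ hz.1 h1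
        obtain ⟨e', he', heq⟩ := h.lazy _ hz.2
        refine ⟨(e, e'), mul_le_mul he he' h.p_pos.le (K.prob_nonneg _ _), ?_⟩
        simp only [prod, heq]
        omega
      · obtain ⟨e, he, hlt⟩ := h.down _ hz.2 (by omega)
        obtain ⟨e', he', heq⟩ := h.lazy _ hz.1
        refine ⟨(e', e), mul_le_mul he' he h.p_pos.le (K.prob_nonneg _ _), ?_⟩
        simp only [prod, heq]
        omega) hA
  refine ⟨D, hD0, fun x hx y hy hxy => ?_⟩
  have := hD (x, y) ⟨hx, hy⟩ hxy
  push_cast at this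
  exact this

theorem closed_prod (h : K.Drift S o N V c C p) : (K.prod K).Closed (S ×ˢ S) := by
  rintro z ⟨h1, h2⟩ e he
  have h1' : 0 < K.prob z.1 e.1 := (K.prob_nonneg _ _).lt_of_ne fun h0 => by
    simp [prod, ← h0] at he
  have h2' : 0 < K.prob z.2 e.2 := (K.prob_nonneg _ _).lt_of_ne fun h0 => by
    simp [prod, ← h0] at he
  exact ⟨h.closed _ h1 _ h1', h.closed _ h2 _ h2'⟩

/-- Expectations of functions of linear growth from two starting points differ by a summable
amount: run two independent copies until they meet at the origin. -/
theorem exists_sum_abs_sub_le (h : K.Drift S o N V c C p) {R : Z → ℝ} {A : ℝ}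
    (hR : ∀ z ∈ S, |R z| ≤ A * (1 + N z)) :
    ∃ D : Z × Z → ℝ, ∀ n, ∀ x ∈ S, ∀ y ∈ S,
      ∑ k ∈ Finset.range n, |(K.op ^ k) R x - (K.op ^ k) R y| ≤ D (x, y) := by
  have hA' : 0 < 2 * (|A| + 1) := by positivity
  obtain ⟨D, hD0, hD⟩ := h.exists_lyapunov_prod hA'
  refine ⟨D, fun n => ?_⟩
  induction n with
  | zero => exact fun x _ y _ => by simpa using hD0 (x, y)
  | succ n ih =>
    intro x hx y hy
    rcases Nat.eq_zero_or_pos (N x + N y) with hN | hN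
    · rw [h.eq_origin x hx (by omega), h.eq_origin y hy (by omega)]
      simpa using hD0 (o, o)
    · have h0 : |R x - R y| ≤ 2 * (|A| + 1) * (1 + (N x + N y)) := by
        have h1 := hR x hx
        have h2 := hR y hy
        have h3 : |R x - R y| ≤ |R x| + |R y| := abs_sub _ _
        have h4 : A * (1 + N x) ≤ (|A| + 1) * (1 + N x) := by
          gcongr; linarith [le_abs_self A]
        have h5 : A * (1 + N y) ≤ (|A| + 1) * (1 + N y) := by
          gcongr; linarith [le_abs_self A]
        have h6 : 0 ≤ (|A| + 1) * (N x + N y) := by positivity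
        linarith
      have hstep : ∀ k, |(K.op ^ (k + 1)) R x - (K.op ^ (k + 1)) R y| ≤
          (K.prod K).op (fun z => |(K.op ^ k) R z.1 - (K.op ^ k) R z.2|) (x, y) := by
        intro k
        rw [pow_succ', Module.End.mul_apply, ← prod_op_fst K K _ (x, y),
          ← prod_op_snd K K ((K.op ^ k) R) (x, y), ← Pi.sub_apply, ← map_sub]
        exact abs_op_le _ _ _
      rw [Finset.sum_range_succ']
      have hsum : ∑ k ∈ Finset.range n, |(K.op ^ (k + 1)) R x - (K.op ^ (k + 1)) R y| ≤
          (K.prod K).op D (x, y) := by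
        refine (Finset.sum_le_sum fun k _ => hstep k).trans ?_
        rw [← Finset.sum_apply, ← map_sum]
        refine op_le_op h.closed_prod (fun z hz => ?_) (Set.mk_mem_prod hx hy)
        rw [Finset.sum_apply]
        exact ih z.1 hz.1 z.2 hz.2
      have := hD x hx y hy hN
      simp only [pow_zero, Module.End.one_apply]
      linarith

/-- The expectations from `o` after `k` and `k + 1` steps differ by an average of differences between
starting points within one step of `o`, so they form a Cauchy sequence. -/
theorem exists_tendsto (h : K.Drift S o N V c C p) {R : Z → ℝ} {A : ℝ}
    (hR : ∀ z ∈ S, |R z| ≤ A * (1 + N z)) :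
    ∃ g, Tendsto (fun k => (K.op ^ k) R o) atTop (𝓝 g) := by
  obtain ⟨D, hD⟩ := h.exists_sum_abs_sub_le hR
  have hdist : ∀ k, dist ((K.op ^ k) R o) ((K.op ^ (k + 1)) R o) ≤
      K.op (fun z => |(K.op ^ k) R z - (K.op ^ k) R o|) o := by
    intro k
    rw [dist_comm, Real.dist_eq, pow_succ', Module.End.mul_apply]
    have h1 : K.op ((K.op ^ k) R) o - (K.op ^ k) R o =
        K.op ((K.op ^ k) R - fun _ => (K.op ^ k) R o) o := by
      rw [map_sub, op_const, Pi.sub_apply]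
    rw [h1]
    exact abs_op_le _ _ _
  refine cauchySeq_tendsto_of_complete (cauchySeq_of_summable_dist ?_)
  refine summable_of_sum_range_le (c := K.op (fun z => D (z, o)) o) (fun _ => dist_nonneg)
    fun n => ?_
  refine (Finset.sum_le_sum fun k _ => hdist k).trans ?_
  rw [← Finset.sum_apply, ← map_sum]
  refine op_le_op h.closed (fun z hz => ?_) h.mem
  rw [Finset.sum_apply]
  exact hD n z hz o h.mem

/-- The limiting mean size is at most the ratio of the two drift constants. -/
theorem limit_size_le (h : K.Drift S o N V c C p) {g : ℝ}
    (hg : Tendsto (fun k => (K.op ^ k) (fun z => (N z : ℝ)) o) atTop (𝓝 g)) : g ≤ C / c := by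
  have hsum : ∀ n, (K.op ^ n) V o +
      c * ∑ k ∈ Finset.range n, (K.op ^ k) (fun z => (N z : ℝ)) o ≤ V o + n * C := by
    intro n
    induction n with
    | zero => simp
    | succ n ih =>
      have h1 : (K.op ^ (n + 1)) V o ≤
          (K.op ^ n) (V + (fun _ => C) - c • fun z => (N z : ℝ)) o := by
        rw [pow_succ, Module.End.mul_apply]
        refine op_pow_le_op_pow h.closed (fun z hz => ?_) n o h.mem
        simpa using h.drift z hz
      rw [map_sub, map_add, map_smul, op_pow_const] at h1
      simp only [Pi.sub_apply, Pi.add_apply, Pi.smul_apply, smul_eq_mul] at h1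
      rw [Finset.sum_range_succ]
      push_cast
      linarith
  have hV : ∀ n, 0 ≤ (K.op ^ n) V o := fun n => by
    have := op_pow_le_op_pow h.closed (f := fun _ => 0) (fun z _ => h.nonneg z) n o h.mem
    rwa [op_pow_const] at this
  have hlim : Tendsto (fun n : ℕ => V o / c * (n : ℝ)⁻¹ + C / c) atTop (𝓝 (C / c)) := by
    simpa using (tendsto_inv_atTop_nhds_zero_nat.const_mul (V o / c)).add_const (C / c)
  refine le_of_tendsto_of_tendsto hg.cesaro hlim ?_
  filter_upwards [eventually_gt_atTop 0] with n hn
  have hn' : (0 : ℝ) < n := by exact_mod_cast hn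
  have h1 := hsum n
  have h2 := hV n
  have hc := h.c_pos
  rw [inv_mul_le_iff₀ hn']
  have h3 : n * (V o / c * (n : ℝ)⁻¹ + C / c) = (V o + n * C) / c := by field_simp
  rw [h3, le_div_iff₀ hc]
  linarith

end Drift

end EventChain

/-! ### Poisson mixtures and time averages -/

/-- The average over `[0, T]` of a function with a limit at infinity has the same limit. -/
theorem tendsto_inv_mul_integral {f : ℝ → ℝ} {g : ℝ}
    (hf : ∀ T, 0 ≤ T → IntervalIntegrable f MeasureTheory.volume 0 T)
    (hg : Tendsto f atTop (𝓝 g)) :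
    Tendsto (fun T : ℝ => T⁻¹ * ∫ t in (0 : ℝ)..T, f t) atTop (𝓝 g) := by
  rw [Metric.tendsto_atTop] at hg ⊢
  intro ε hε
  obtain ⟨T₀, hT₀⟩ := hg (ε / 2) (by positivity)
  set T₁ := max T₀ 0
  have hT₁ : 0 ≤ T₁ := le_max_right _ _
  set I := |∫ t in (0 : ℝ)..T₁, (f t - g)| with hI
  refine ⟨max T₁ 0 + 2 * I / ε + 1, fun T hT => ?_⟩
  have hI0 : 0 ≤ 2 * I / ε := by positivity
  have hTT : T₁ ≤ T := by linarith [le_max_left T₁ 0]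
  have hT0 : 0 < T := by linarith [le_max_right T₁ 0]
  have hint : ∀ T, 0 ≤ T → IntervalIntegrable (fun t => f t - g) MeasureTheory.volume 0 T :=
    fun T hT => (hf T hT).sub intervalIntegrable_const
  have h1 : ∫ t in (0 : ℝ)..T, (f t - g) = (∫ t in (0 : ℝ)..T, f t) - T * g := by
    rw [intervalIntegral.integral_sub (hf T hT0.le) intervalIntegrable_const]
    simp
  have h2 : ∫ t in (0 : ℝ)..T, (f t - g) =
      (∫ t in (0 : ℝ)..T₁, (f t - g)) + ∫ t in T₁..T, (f t - g) :=
    (intervalIntegral.integral_add_adjacent_intervals (hint T₁ hT₁)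
      ((hint T₁ hT₁).symm.trans (hint T hT0.le))).symm
  have h3 : |∫ t in T₁..T, (f t - g)| ≤ ε / 2 * |T - T₁| := by
    rw [← Real.norm_eq_abs]
    refine intervalIntegral.norm_integral_le_of_norm_le_const fun t ht => ?_
    rw [Set.uIoc_of_le hTT] at ht
    exact (hT₀ t ((le_max_left _ _).trans ht.1.le)).le
  have h4 : |∫ t in (0 : ℝ)..T, (f t - g)| < ε * T := by
    have h5 : I < ε / 2 * T := by
      have h6 : 2 * I / ε < T := by linarith [le_max_right T₁ 0]
      rw [div_lt_iff₀ hε] at h6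
      linarith
    have h7 : ε / 2 * |T - T₁| ≤ ε / 2 * T := by
      rw [abs_of_nonneg (by linarith)]
      gcongr
      linarith
    rw [h2]
    refine (abs_add_le _ _).trans_lt ?_
    linarith
  rw [Real.dist_eq]
  have h5 : T⁻¹ * (∫ t in (0 : ℝ)..T, f t) - g = T⁻¹ * ∫ t in (0 : ℝ)..T, (f t - g) := by
    rw [h1]
    field_simp
  rw [h5, abs_mul, abs_of_pos (inv_pos.2 hT0), inv_mul_lt_iff₀ hT0]
  linarith

/-- The probability that a Poisson variable of mean `t` equals `k`. -/
noncomputable def poissonWeight (t : ℝ) (k : ℕ) : ℝ := Real.exp (-t) * t ^ k / k.factorial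

theorem poissonWeight_nonneg {t : ℝ} (ht : 0 ≤ t) (k : ℕ) : 0 ≤ poissonWeight t k := by
  unfold poissonWeight
  positivity

theorem hasSum_poissonWeight {t : ℝ} (ht : 0 ≤ t) : HasSum (poissonWeight t) 1 :=
  ProbabilityTheory.hasSum_one_poissonMeasure ⟨t, ht⟩

theorem summable_poissonWeight_mul {t : ℝ} (ht : 0 ≤ t) {a : ℕ → ℝ} {M : ℝ}
    (ha : ∀ k, |a k| ≤ M) : Summable fun k => poissonWeight t k * a k := by
  refine Summable.of_norm_bounded ((hasSum_poissonWeight ht).summable.mul_right M) fun k => ?_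
  rw [norm_mul, Real.norm_of_nonneg (poissonWeight_nonneg ht k)]
  exact mul_le_mul_of_nonneg_left (ha k) (poissonWeight_nonneg ht k)

theorem tendsto_poissonWeight (k : ℕ) : Tendsto (fun t => poissonWeight t k) atTop (𝓝 0) := by
  have h := (Real.tendsto_pow_mul_exp_neg_atTop_nhds_zero k).div_const (k.factorial : ℝ)
  rw [zero_div] at h
  exact h.congr fun t => by rw [poissonWeight, mul_comm]

/-- Poisson averages of a convergent sequence converge to its limit as the mean tends to
infinity. -/
theorem tendsto_tsum_poissonWeight_mul {a : ℕ → ℝ} {g : ℝ} (hg : Tendsto a atTop (𝓝 g)) :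
    Tendsto (fun t => ∑' k, poissonWeight t k * a k) atTop (𝓝 g) := by
  obtain ⟨M, hM⟩ : ∃ M, ∀ k, |a k| ≤ M := by
    obtain ⟨M, hM⟩ := hg.norm.bddAbove_range
    exact ⟨M, fun k => hM ⟨k, rfl⟩⟩
  have hM' : ∀ k, |a k - g| ≤ M + |g| := fun k => (abs_sub _ _).trans (by linarith [hM k])
  have hM0 : 0 ≤ M + |g| := (abs_nonneg _).trans (hM' 0)
  rw [Metric.tendsto_nhds]
  intro ε hε
  obtain ⟨n₀, hn₀⟩ := (Metric.tendsto_atTop.1 hg) (ε / 2) (by positivity)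
  have hsmall : Tendsto (fun t => (M + |g|) * ∑ k ∈ Finset.range n₀, poissonWeight t k) atTop
      (𝓝 0) := by
    simpa using (tendsto_finsetSum (Finset.range n₀)
      fun k _ => tendsto_poissonWeight k).const_mul (M + |g|)
  filter_upwards [hsmall.eventually_lt_const (show 0 < ε / 2 by positivity),
    eventually_ge_atTop 0] with t ht ht0
  have hw := hasSum_poissonWeight ht0
  have h1 : (∑' k, poissonWeight t k * a k) - g = ∑' k, poissonWeight t k * (a k - g) := by
    have h2 : ∑' k, poissonWeight t k * g = g := by rw [tsum_mul_right, hw.tsum_eq, one_mul]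
    conv_lhs => rw [← h2]
    rw [← (summable_poissonWeight_mul ht0 hM).tsum_sub (hw.summable.mul_right g)]
    exact tsum_congr fun k => by ring
  let G : ℕ → ℝ := fun k => if k ∈ Finset.range n₀ then (M + |g|) * poissonWeight t k else 0
  have hG : HasSum G (∑ k ∈ Finset.range n₀, G k) :=
    hasSum_sum_of_ne_finset_zero fun k hk => if_neg hk
  have hG' : ∑ k ∈ Finset.range n₀, G k = (M + |g|) * ∑ k ∈ Finset.range n₀, poissonWeight t k := by
    rw [Finset.mul_sum]
    exact Finset.sum_congr rfl fun k hk => if_pos hk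
  have hbound : ∀ k, ‖poissonWeight t k * (a k - g)‖ ≤ poissonWeight t k * (ε / 2) + G k := by
    intro k
    have hwk := poissonWeight_nonneg ht0 k
    rw [norm_mul, Real.norm_of_nonneg hwk, Real.norm_eq_abs]
    by_cases hk : k ∈ Finset.range n₀
    · simp only [G, if_pos hk]
      have h3 := mul_le_mul_of_nonneg_left (hM' k) hwk
      have h4 : 0 ≤ poissonWeight t k * (ε / 2) := by positivity
      linarith
    · simp only [G, if_neg hk, add_zero]
      exact mul_le_mul_of_nonneg_left
        (hn₀ k (not_lt.1 fun h => hk (Finset.mem_range.2 h))).le hwk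
  have h2 := tsum_of_norm_bounded ((hw.mul_right (ε / 2)).add hG) hbound
  rw [hG'] at h2
  rw [Real.dist_eq, h1]
  rw [Real.norm_eq_abs] at h2
  linarith

theorem continuousOn_tsum_poissonWeight_mul {a : ℕ → ℝ} {M : ℝ} (ha : ∀ k, |a k| ≤ M) :
    ContinuousOn (fun t => ∑' k, poissonWeight t k * a k) (Set.Ici 0) := by
  have hloc : ∀ B : ℝ, 0 ≤ B →
      ContinuousOn (fun t => ∑' k, poissonWeight t k * a k) (Set.Icc 0 B) := by
    intro B hB
    have hs : Summable fun k : ℕ => B ^ k / k.factorial * M :=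
      (Real.summable_pow_div_factorial B).mul_right M
    have hc : ∀ k, ContinuousOn (fun t => poissonWeight t k * a k) (Set.Icc 0 B) := fun k => by
      unfold poissonWeight
      exact Continuous.continuousOn (by fun_prop)
    refine continuousOn_tsum hc hs fun k t ht => ?_
    rw [norm_mul, Real.norm_of_nonneg (poissonWeight_nonneg ht.1 k), Real.norm_eq_abs]
    refine mul_le_mul ?_ (ha k) (abs_nonneg _) (by positivity)
    unfold poissonWeight
    have h1 : Real.exp (-t) ≤ 1 := Real.exp_le_one_iff.2 (by linarith [ht.1])
    have h2 : t ^ k ≤ B ^ k := pow_le_pow_left₀ ht.1 ht.2 k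
    have h3 : Real.exp (-t) * t ^ k ≤ 1 * B ^ k :=
      mul_le_mul h1 h2 (pow_nonneg ht.1 k) zero_le_one
    rw [one_mul] at h3
    gcongr
  intro t ht
  have ht' : (0 : ℝ) ≤ t := ht
  have h1 := hloc (t + 1) (by linarith) t ⟨ht, by linarith⟩
  refine h1.mono_of_mem_nhdsWithin ?_
  rw [← Set.Ici_inter_Iic]
  exact Filter.inter_mem self_mem_nhdsWithin
    (mem_nhdsWithin_of_mem_nhds (Iic_mem_nhds (by linarith)))

/-! ### The uniformized chain of a queueing system -/

namespace ArrivalRates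

variable {n m : ℕ}

/-- The uniformized chain, with arrivals of servers and customers and idle steps as events. -/
noncomputable def eventChain (a : ArrivalRates n m) (r : MatchingRule n m) :
    EventChain (QueueState n m) (Option (Fin n ⊕ Fin m)) where
  prob q e := a.eventProb q e
  next := r.next
  prob_nonneg q e := (a.eventProb q e).2
  sum_prob q := by
    have h : ((∑ e, a.eventProb q e : ℝ≥0) : ℝ≥0∞) = 1 := by
      rw [ENNReal.ofNNReal_finsetSum]
      exact a.sum_eventProb q
    exact_mod_cast h

theorem step_apply (a : ArrivalRates n m) (r : MatchingRule n m) (q q' : QueueState n m) :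
    a.step r q q' = ∑ e, if q' = r.next q e then (a.eventProb q e : ℝ≥0∞) else 0 := by
  rw [step, PMF.map_apply, tsum_fintype]
  refine Finset.sum_congr rfl fun e _ => ?_
  rw [PMF.ofFintype_apply]
  congr

theorem tsum_step_mul (a : ArrivalRates n m) (r : MatchingRule n m) (q : QueueState n m)
    (f : QueueState n m → ℝ≥0∞) :
    ∑' q', a.step r q q' * f q' = ∑ e, (a.eventProb q e : ℝ≥0∞) * f (r.next q e) := by
  simp only [step_apply, Finset.sum_mul]
  rw [Summable.tsum_finsetSum fun _ _ => ENNReal.summable]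
  refine Finset.sum_congr rfl fun e _ => ?_
  rw [tsum_eq_single (r.next q e) fun q' hq' => by rw [if_neg hq', zero_mul], if_pos rfl]

theorem toReal_step (a : ArrivalRates n m) (r : MatchingRule n m) (q q' : QueueState n m) :
    (a.step r q q').toReal = (a.eventChain r).op (Pi.single q' 1) q := by
  rw [step_apply, ENNReal.toReal_sum fun e _ => by split_ifs <;> simp, EventChain.op_apply]
  refine Finset.sum_congr rfl fun e _ => ?_
  simp only [eventChain, Pi.single_apply, eq_comm (a := q')]
  split_ifs <;> simp

theorem toReal_chain (a : ArrivalRates n m) (r : MatchingRule n m) (k : ℕ) (q : QueueState n m) :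
    (a.chain r k q).toReal = ((a.eventChain r).op ^ k) (Pi.single q 1) 0 := by
  induction k generalizing q with
  | zero =>
    simp only [chain, PMF.pure_apply, pow_zero, Module.End.one_apply, Pi.single_apply,
      eq_comm (a := q)]
    split_ifs <;> simp
  | succ k ih =>
    rw [chain, PMF.bind_apply, ENNReal.tsum_toReal_eq fun q' =>
      ENNReal.mul_ne_top (PMF.apply_ne_top _ _) (PMF.apply_ne_top _ _)]
    simp only [ENNReal.toReal_mul, ih, toReal_step]
    rw [(EventChain.hasSum_op_pow_single _ _ _ _).tsum_eq, pow_succ, Module.End.mul_apply]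

theorem hasSum_chain_mul (a : ArrivalRates n m) (r : MatchingRule n m) (k : ℕ)
    (f : QueueState n m → ℝ) :
    HasSum (fun q => (a.chain r k q).toReal * f q) (((a.eventChain r).op ^ k) f 0) := by
  simp only [toReal_chain]
  exact EventChain.hasSum_op_pow_single _ _ _ _

theorem toReal_law (a : ArrivalRates n m) (r : MatchingRule n m) (t : ℝ≥0) (q : QueueState n m) :
    (a.law r t q).toReal = ∑' k, poissonWeight (a.cap * t) k * (a.chain r k q).toReal := by
  rw [law, PMF.bind_apply, ENNReal.tsum_toReal_eq fun k =>
      ENNReal.mul_ne_top (PMF.apply_ne_top _ _) (PMF.apply_ne_top _ _)]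
  refine tsum_congr fun k => ?_
  rw [ENNReal.toReal_mul, MeasureTheory.Measure.toPMF_apply,
    ProbabilityTheory.poissonMeasure_singleton, ENNReal.toReal_ofReal (by positivity),
    NNReal.coe_mul]
  rfl

/-- Expectations at time `t` are Poisson mixtures of expectations along the uniformized chain. -/
theorem hasSum_law_mul (a : ArrivalRates n m) (r : MatchingRule n m) (t : ℝ≥0)
    {R : QueueState n m → ℝ} {M : ℝ} (hM : ∀ k, ((a.eventChain r).op ^ k) (fun q => |R q|) 0 ≤ M) :
    HasSum (fun q => (a.law r t q).toReal * R q)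
      (∑' k, poissonWeight (a.cap * t) k * ((a.eventChain r).op ^ k) R 0) := by
  have ht : (0 : ℝ) ≤ a.cap * t := by positivity
  have h0 : ∀ k, 0 ≤ ((a.eventChain r).op ^ k) (fun q => |R q|) 0 := fun k =>
    (hasSum_chain_mul a r k fun q => |R q|).nonneg fun q =>
      mul_nonneg ENNReal.toReal_nonneg (abs_nonneg _)
  let F : ℕ × QueueState n m → ℝ := fun z =>
    poissonWeight (a.cap * t) z.1 * ((a.chain r z.1 z.2).toReal * R z.2)
  have habs : ∀ z : ℕ × QueueState n m, ‖F z‖ =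
      poissonWeight (a.cap * t) z.1 * ((a.chain r z.1 z.2).toReal * |R z.2|) := fun z => by
    rw [norm_mul, norm_mul, Real.norm_of_nonneg (poissonWeight_nonneg ht _),
      Real.norm_of_nonneg ENNReal.toReal_nonneg, Real.norm_eq_abs]
  have hF : Summable F := by
    refine Summable.of_norm ((summable_prod_of_nonneg fun z => norm_nonneg _).2 ⟨fun k => ?_, ?_⟩)
    · simp only [habs]
      exact ((hasSum_chain_mul a r k fun q => |R q|).mul_left _).summable
    · simp only [habs]
      have h1 : ∀ k, ∑' q, poissonWeight (a.cap * t) k * ((a.chain r k q).toReal * |R q|) =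
          poissonWeight (a.cap * t) k * ((a.eventChain r).op ^ k) (fun q => |R q|) 0 := fun k =>
        ((hasSum_chain_mul a r k fun q => |R q|).mul_left _).tsum_eq
      simp only [h1]
      exact summable_poissonWeight_mul ht (M := M) fun k => by rw [abs_of_nonneg (h0 k)]; exact hM k
  have h2 : ∑' k, poissonWeight (a.cap * t) k * ((a.eventChain r).op ^ k) R 0 = ∑' z, F z := by
    rw [hF.tsum_prod]
    exact tsum_congr fun k => ((hasSum_chain_mul a r k R).mul_left _).tsum_eq.symm
  have hFs : HasSum (fun z : QueueState n m × ℕ => F z.swap) (∑' z, F z) :=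
    (Equiv.prodComm _ _).hasSum_iff.2 hF.hasSum
  rw [h2]
  refine hFs.prod_fiberwise fun q => ?_
  have h3 : (fun k => F (q, k).swap) =
      fun k => poissonWeight (a.cap * t) k * (a.chain r k q).toReal * R q := by
    ext k
    simp only [F, Prod.swap_prod_mk, mul_assoc]
  rw [h3, toReal_law]
  refine (Summable.hasSum ?_).mul_right _
  exact summable_poissonWeight_mul ht (M := 1) fun k => by
    rw [abs_of_nonneg ENNReal.toReal_nonneg]
    exact ENNReal.toReal_le_of_le_ofReal zero_le_one (by simpa using PMF.coe_le_one _ _)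

/-- If the expectations along the uniformized chain converge, then so does the time average. -/
theorem hasLongRunAverage_of_tendsto (a : ArrivalRates n m) (r : MatchingRule n m)
    {R : QueueState n m → ℝ} {M g : ℝ}
    (hM : ∀ k, ((a.eventChain r).op ^ k) (fun q => |R q|) 0 ≤ M)
    (hg : Tendsto (fun k => ((a.eventChain r).op ^ k) R 0) atTop (𝓝 g)) :
    a.HasLongRunAverage r R g := by
  have hb : ∀ k, |((a.eventChain r).op ^ k) R 0| ≤ M := fun k => by
    refine le_trans (abs_le.2 ⟨?_, ?_⟩) (hM k)
    · have := EventChain.op_pow_le_op_pow (K := a.eventChain r) (S := Set.univ)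
        (fun _ _ _ _ => trivial) (f := -fun q => |R q|) (g := R)
        (fun q _ => neg_abs_le (R q)) k 0 trivial
      rwa [map_neg] at this
    · exact EventChain.op_pow_le_op_pow (K := a.eventChain r) (S := Set.univ)
        (fun _ _ _ _ => trivial) (fun q _ => le_abs_self (R q)) k 0 trivial
  have hE : ∀ t : ℝ, ∑' q, (a.law r t.toNNReal q).toReal * R q =
      ∑' k, poissonWeight (a.cap * t.toNNReal) k * ((a.eventChain r).op ^ k) R 0 := fun t =>
    (hasSum_law_mul a r t.toNNReal hM).tsum_eq
  have hcap : (0 : ℝ) < a.cap := by exact_mod_cast a.cap_pos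
  have hint : ∀ T : ℝ, 0 ≤ T → IntervalIntegrable
      (fun t : ℝ => ∑' q, (a.law r t.toNNReal q).toReal * R q) MeasureTheory.volume 0 T := by
    intro T _
    refine Continuous.intervalIntegrable ?_ 0 T
    simp only [hE]
    refine (continuousOn_tsum_poissonWeight_mul hb).comp_continuous
      (f := fun t : ℝ => (a.cap : ℝ) * t.toNNReal) (by fun_prop) fun t => ?_
    exact mul_nonneg hcap.le t.toNNReal.2
  refine ⟨fun t => (hasSum_law_mul a r t hM).summable, hint, tendsto_inv_mul_integral hint ?_⟩
  have h1 : Tendsto (fun t : ℝ => (a.cap : ℝ) * t) atTop atTop :=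
    tendsto_id.const_mul_atTop hcap
  refine ((tendsto_tsum_poissonWeight_mul hg).comp h1).congr' ?_
  filter_upwards [eventually_ge_atTop 0] with t ht
  rw [hE, Function.comp_apply, Real.coe_toNNReal t ht]

theorem mem_of_reachable {a : ArrivalRates n m} {r : MatchingRule n m} {S : Set (QueueState n m)}
    (hS : (a.eventChain r).Closed S) (h0 : (0 : QueueState n m) ∈ S) {q : QueueState n m}
    (hq : a.Reachable r q) : q ∈ S := by
  obtain ⟨k, hk⟩ := hq
  induction k generalizing q with
  | zero =>
    simp only [chain, PMF.support_pure, Set.mem_singleton_iff] at hk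
    rwa [hk]
  | succ k ih =>
    simp only [chain, PMF.mem_support_bind_iff, step, PMF.mem_support_map_iff] at hk
    obtain ⟨q', hq', e, he, rfl⟩ := hk
    refine hS q' (ih hq') e ?_
    have h1 : (a.eventProb q' e : ℝ≥0∞) ≠ 0 := he
    have h2 : a.eventProb q' e ≠ 0 := by exact_mod_cast h1
    exact_mod_cast pos_iff_ne_zero.2 h2

/-- Positive recurrence of the empty state from a Lyapunov function. -/
theorem stable_of_drift {a : ArrivalRates n m} {r : MatchingRule n m} {S : Set (QueueState n m)}
    {N : QueueState n m → ℕ} {V : QueueState n m → ℝ} {c C p : ℝ}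
    (h : (a.eventChain r).Drift S 0 N V c C p) : a.Stable r := by
  obtain ⟨U, hU0, hU⟩ := (a.eventChain r).exists_lyapunov h.nonneg h.c_pos h.p_pos h.p_le_one
    h.drift h.down one_pos
  have hsucc : ∀ l q, ∑ k ∈ Finset.range (l + 1), a.avoidProb r k q = 1 + ∑ e,
      (a.eventProb q e : ℝ≥0∞) * (if r.next q e = 0 then 0 else
        ∑ k ∈ Finset.range l, a.avoidProb r k (r.next q e)) := by
    intro l q
    rw [Finset.sum_range_succ', add_comm]
    simp only [avoidProb, tsum_step_mul]
    rw [Finset.sum_comm]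
    congr 1
    refine Finset.sum_congr rfl fun e _ => ?_
    rw [← Finset.mul_sum]
    split_ifs <;> simp
  have hstep : ∀ l, (∀ q ∈ S, q ≠ 0 →
      ∑ k ∈ Finset.range l, a.avoidProb r k q ≤ ENNReal.ofReal (U q)) → ∀ q ∈ S,
      ∑ k ∈ Finset.range (l + 1), a.avoidProb r k q ≤
        ENNReal.ofReal (1 + (a.eventChain r).op U q) := by
    intro l ih q hq
    rw [hsucc, EventChain.op_apply, ENNReal.ofReal_add zero_le_one (Finset.sum_nonneg fun e _ =>
      mul_nonneg ((a.eventChain r).prob_nonneg _ _) (hU0 _)), ENNReal.ofReal_one,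
      ENNReal.ofReal_sum_of_nonneg fun e _ =>
        mul_nonneg ((a.eventChain r).prob_nonneg _ _) (hU0 _)]
    gcongr with e _
    rw [ENNReal.ofReal_mul ((a.eventChain r).prob_nonneg _ _)]
    have h1 : ENNReal.ofReal ((a.eventChain r).prob q e) = a.eventProb q e :=
      ENNReal.ofReal_coe_nnreal
    rw [h1]
    rcases eq_or_ne (a.eventProb q e) 0 with h0 | h0
    · simp [h0]
    · gcongr
      split_ifs with hz
      · exact zero_le
      · refine ih _ (h.closed q hq e ?_) hz
        exact_mod_cast pos_iff_ne_zero.2 h0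
  have hbound : ∀ l, ∀ q ∈ S, q ≠ 0 →
      ∑ k ∈ Finset.range l, a.avoidProb r k q ≤ ENNReal.ofReal (U q) := by
    intro l
    induction l with
    | zero => intro q _ _; simp
    | succ l ih =>
      intro q hq hq0
      refine (hstep l ih q hq).trans (ENNReal.ofReal_le_ofReal ?_)
      have hN : 0 < N q := Nat.pos_of_ne_zero fun h0 => hq0 (h.eq_origin q hq h0)
      have h1 := hU q hq hN
      have h2 : (0 : ℝ) ≤ N q := Nat.cast_nonneg _
      linarith
  refine ENNReal.mul_ne_top (ENNReal.inv_ne_top.2 (by exact_mod_cast a.cap_pos.ne')) ?_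
  refine ne_top_of_le_ne_top ENNReal.ofReal_ne_top (ENNReal.tsum_le_of_sum_range_le
    (c := ENNReal.ofReal (1 + (a.eventChain r).op U 0)) fun l => ?_)
  refine le_trans ?_ (hstep l (hbound l) 0 h.mem)
  rw [Finset.sum_range_succ]
  exact le_self_add

end ArrivalRates

/-! ### Limiting mean rewards -/

namespace EventChain.Drift

variable {Z E : Type*} [Fintype E] {K : EventChain Z E} {S : Set Z} {o : Z} {N : Z → ℕ}
  {V : Z → ℝ} {c C p : ℝ}

/-- If a reward `R` differs from the constant `b` by a multiple of the drift of `h`, by the cost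
`s * N` and by an error of at most `ε`, then its limiting mean is close to `b`, because the
expectation of `h` converges and hence its drift vanishes in the limit. -/
theorem exists_tendsto_reward (hD : K.Drift S o N V c C p) {R h : Z → ℝ} {A A' b l s ε : ℝ}
    (hs : 0 ≤ s) (hR : ∀ z ∈ S, |R z| ≤ A * (1 + N z)) (hh : ∀ z ∈ S, |h z| ≤ A' * (1 + N z))
    (herr : ∀ z ∈ S, |R z - (b + l * (K.op h z - h z)) + s * N z| ≤ ε) :
    ∃ g, Tendsto (fun k => (K.op ^ k) R o) atTop (𝓝 g) ∧ |g - b| ≤ ε + s * (C / c) := by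
  obtain ⟨g, hg⟩ := hD.exists_tendsto hR
  obtain ⟨gh, hgh⟩ := hD.exists_tendsto hh
  obtain ⟨gN, hgN⟩ := hD.exists_tendsto (R := fun z => (N z : ℝ)) (A := 1) fun z _ => by
    rw [Nat.abs_cast]
    linarith
  refine ⟨g, hg, ?_⟩
  let err : Z → ℝ := R - ((fun _ => b) + l • (K.op h - h)) + s • fun z => (N z : ℝ)
  have herr' : ∀ k, |(K.op ^ k) err o| ≤ ε := by
    intro k
    have h1 := op_pow_le_op_pow hD.closed (f := err) (g := fun _ => ε)
      (fun z hz => (abs_le.1 (herr z hz)).2) k o hD.mem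
    have h2 := op_pow_le_op_pow hD.closed (f := fun _ => -ε) (g := err)
      (fun z hz => (abs_le.1 (herr z hz)).1) k o hD.mem
    rw [op_pow_const] at h1 h2
    exact abs_le.2 ⟨h2, h1⟩
  have hexp : ∀ k, (K.op ^ k) err o = (K.op ^ k) R o -
      (b + l * ((K.op ^ (k + 1)) h o - (K.op ^ k) h o)) + s * (K.op ^ k) (fun z => (N z : ℝ)) o := by
    intro k
    simp only [err, map_add, map_sub, map_smul, op_pow_const]
    rw [pow_succ, Module.End.mul_apply]
    rfl
  have hlim : Tendsto (fun k => (K.op ^ k) err o) atTop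
      (𝓝 (g - (b + l * (gh - gh)) + s * gN)) := by
    simp only [hexp]
    exact (hg.sub ((((hgh.comp (tendsto_add_atTop_nat 1)).sub hgh).const_mul l).const_add b)).add
      (hgN.const_mul s)
  have h1 : |g - (b + l * (gh - gh)) + s * gN| ≤ ε :=
    le_of_tendsto hlim.abs (Eventually.of_forall herr')
  have h2 : gN ≤ C / c := hD.limit_size_le hgN
  have h3 : 0 ≤ gN := ge_of_tendsto' hgN fun k => by
    have := op_pow_le_op_pow hD.closed (f := fun _ => 0) (g := fun z => (N z : ℝ))
      (fun z _ => Nat.cast_nonneg _) k o hD.mem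
    rwa [op_pow_const] at this
  have h4 : s * gN ≤ s * (C / c) := mul_le_mul_of_nonneg_left h2 hs
  have h5 : 0 ≤ s * gN := mul_nonneg hs h3
  rw [sub_self, mul_zero, add_zero] at h1
  rw [abs_le] at h1 ⊢
  constructor <;> linarith

end EventChain.Drift

/-! ### The fluid problem -/

theorem Fintype.sum_apply_update {ι α : Type*} [Fintype ι] [DecidableEq ι] (g : ι → α → ℝ)
    (f : ι → α) (k : ι) (v : α) :
    ∑ i, g i (Function.update f k v i) = ∑ i, g i (f i) + (g k v - g k (f k)) := by
  rw [← sub_eq_iff_eq_add', ← Finset.sum_sub_distrib, Finset.sum_eq_single k]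
  · simp
  · intro i _ hi
    simp [hi]
  · simp

namespace TwoSidedQueue

variable {n m : ℕ} {M : TwoSidedQueue n m} {x : FluidPoint n m}

theorem FluidFeasible.chi_nonneg' (hx : M.FluidFeasible x) (i : Fin n) (j : Fin m) :
    0 ≤ x.chi i j := by
  by_cases h : (i, j) ∈ M.edges
  · exact hx.chi_nonneg i j h
  · exact (hx.chi_zero i j h).ge

theorem FluidFeasible.mem_fluidSupport (hx : M.FluidFeasible x) {i : Fin n} {j : Fin m}
    (h : x.chi i j ≠ 0) : (i, j) ∈ M.fluidSupport x :=
  ⟨by_contra fun he => h (hx.chi_zero i j he), (hx.chi_nonneg' i j).lt_of_ne' h⟩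

theorem FluidFeasible.lam_pos (hx : M.FluidFeasible x) {i : Fin n} {j : Fin m}
    (h : (i, j) ∈ M.fluidSupport x) : 0 < x.lam j :=
  h.2.trans_le (hx.lam_eq j ▸ Finset.single_le_sum (f := fun i => x.chi i j)
    (fun i _ => hx.chi_nonneg' i j) (Finset.mem_univ i))

theorem FluidFeasible.mu_pos (hx : M.FluidFeasible x) {i : Fin n} {j : Fin m}
    (h : (i, j) ∈ M.fluidSupport x) : 0 < x.mu i :=
  h.2.trans_le (hx.mu_eq i ▸ Finset.single_le_sum (f := fun j => x.chi i j)
    (fun j _ => hx.chi_nonneg' i j) (Finset.mem_univ j))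

theorem FluidFeasible.exists_server (hx : M.FluidFeasible x) {j : Fin m} (h : x.lam j ≠ 0) :
    ∃ i, (i, j) ∈ M.fluidSupport x := by
  rw [hx.lam_eq] at h
  obtain ⟨i, _, hi⟩ := Finset.exists_ne_zero_of_sum_ne_zero h
  exact ⟨i, hx.mem_fluidSupport hi⟩

theorem FluidFeasible.exists_customer (hx : M.FluidFeasible x) {i : Fin n} (h : x.mu i ≠ 0) :
    ∃ j, (i, j) ∈ M.fluidSupport x := by
  rw [hx.mu_eq] at h
  obtain ⟨j, _, hj⟩ := Finset.exists_ne_zero_of_sum_ne_zero h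
  exact ⟨j, hx.mem_fluidSupport hj⟩

/-- Scaling the rates maps the feasible points of `M` onto those of the `η`-th system, and the
objective scales along. -/
theorem fluidValue_scaled (hx : M.FluidOptimal x) {η : ℕ} (hη : 0 < η) :
    (M.scaled η).fluidValue = η * M.fluidObjective x := by
  have hη' : (0 : ℝ) < η := by exact_mod_cast hη
  have hobj : ∀ y : FluidPoint n m, (M.scaled η).fluidObjective y =
      η * M.fluidObjective ⟨fun j => y.lam j / η, fun i => y.mu i / η, fun i j => y.chi i j / η⟩ := by
    intro y
    simp only [fluidObjective, scaled, mul_sub, Finset.mul_sum]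
    congr 1 <;> refine Finset.sum_congr rfl fun _ _ => ?_ <;> field_simp
  refine IsGreatest.csSup_eq ⟨?_, ?_⟩
  · have hback : ∀ a : ℝ, η * a / η = a := fun a => mul_div_cancel_left₀ a hη'.ne'
    refine ⟨⟨fun j => η * x.lam j, fun i => η * x.mu i, fun i j => η * x.chi i j⟩, ?_, ?_⟩
    · have hf := hx.1
      constructor
      · intro j
        simpa [scaled, hback] using hf.lam_mem j
      · intro i
        simpa [scaled, hback] using hf.mu_mem i
      · intro j
        simp only [hf.lam_eq j, Finset.mul_sum]
      · intro i
        simp only [hf.mu_eq i, Finset.mul_sum]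
      · intro i j h
        simp only [hf.chi_zero i j h, mul_zero]
      · intro i j h
        exact mul_nonneg hη'.le (hf.chi_nonneg i j h)
    · rw [hobj]
      simp only [hback]
  · rintro _ ⟨y, hy, rfl⟩
    rw [hobj]
    refine mul_le_mul_of_nonneg_left (hx.2 _ ?_) hη'.le
    constructor
    · exact hy.lam_mem
    · exact hy.mu_mem
    · intro j
      simp only [hy.lam_eq j, Finset.sum_div]
    · intro i
      simp only [hy.mu_eq i, Finset.sum_div]
    · intro i j h
      simp only [hy.chi_zero i j h, zero_div]
    · intro i j h
      exact div_nonneg (hy.chi_nonneg i j h) hη'.le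

/-- First-order optimality along an edge that carries flow: marginal revenue equals marginal
cost. -/
theorem FluidOptimal.deriv_eq (hM : M.Regular) (hx : M.FluidOptimal x)
    (hlam : ∀ j, x.lam j = 0 ∨ x.lam j ∈ interior (M.domF j))
    (hmu : ∀ i, x.mu i = 0 ∨ x.mu i ∈ interior (M.domG i))
    {i : Fin n} {j : Fin m} (h : (i, j) ∈ M.fluidSupport x) :
    deriv (fun y => y * M.F j y) (x.lam j) = deriv (fun y => y * M.G i y) (x.mu i) := by
  have hF := (hlam j).resolve_left (hx.1.lam_pos h).ne'
  have hG := (hmu i).resolve_left (hx.1.mu_pos h).ne'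
  have hdF : DifferentiableAt ℝ (fun y => y * M.F j y) (x.lam j) :=
    differentiableAt_id.mul (((hM.F_smooth j).contDiffAt
      (mem_interior_iff_mem_nhds.1 hF)).differentiableAt (by norm_num))
  have hdG : DifferentiableAt ℝ (fun y => y * M.G i y) (x.mu i) :=
    differentiableAt_id.mul (((hM.G_smooth i).contDiffAt
      (mem_interior_iff_mem_nhds.1 hG)).differentiableAt (by norm_num))
  let f : ℝ → ℝ := fun t => (x.lam j + t) * M.F j (x.lam j + t) - (x.mu i + t) * M.G i (x.mu i + t)
  have hf : HasDerivAt f (deriv (fun y => y * M.F j y) (x.lam j) -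
      deriv (fun y => y * M.G i y) (x.mu i)) 0 := by
    refine HasDerivAt.sub ?_ ?_
    · refine HasDerivAt.comp_const_add (f := fun y => y * M.F j y) (x.lam j) 0 ?_
      rw [add_zero]
      exact hdF.hasDerivAt
    · refine HasDerivAt.comp_const_add (f := fun y => y * M.G i y) (x.mu i) 0 ?_
      rw [add_zero]
      exact hdG.hasDerivAt
  have hmax : IsLocalMax f 0 := by
    have hcont : ∀ a : ℝ, Tendsto (fun t => a + t) (𝓝 0) (𝓝 a) := fun a => by
      simpa using (tendsto_id (x := 𝓝 (0 : ℝ))).const_add a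
    filter_upwards [(hcont _).eventually (mem_interior_iff_mem_nhds.1 hF),
      (hcont _).eventually (mem_interior_iff_mem_nhds.1 hG),
      (hcont (x.chi i j)).eventually_const_lt h.2] with t htF htG htχ
    -- the flow along the edge is changed by `t`
    let y : FluidPoint n m :=
      ⟨Function.update x.lam j (x.lam j + t), Function.update x.mu i (x.mu i + t),
        Function.update x.chi i (Function.update (x.chi i) j (x.chi i j + t))⟩
    have hχ : ∀ i' j', y.chi i' j' = x.chi i' j' + if i' = i ∧ j' = j then t else 0 := by
      intro i' j'
      by_cases hi : i' = i
      · subst hi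
        by_cases hj : j' = j
        · subst hj
          simp [y]
        · simp [y, hj]
      · simp [y, hi]
    have hy : M.FluidFeasible y := by
      constructor
      · intro j'
        by_cases hj : j' = j
        · subst hj
          simp only [y, Function.update_self]
          exact htF
        · simpa [y, hj] using hx.1.lam_mem j'
      · intro i'
        by_cases hi : i' = i
        · subst hi
          simp only [y, Function.update_self]
          exact htG
        · simpa [y, hi] using hx.1.mu_mem i'
      · intro j'
        simp only [hχ, Finset.sum_add_distrib, ← hx.1.lam_eq]
        by_cases hj : j' = j
        · subst hj
          simp [y]
        · simp [y, hj]
      · intro i'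
        simp only [hχ, Finset.sum_add_distrib, ← hx.1.mu_eq]
        by_cases hi : i' = i
        · subst hi
          simp [y]
        · simp [y, hi]
      · intro i' j' he
        have hne : ¬(i' = i ∧ j' = j) := by
          rintro ⟨rfl, rfl⟩
          exact he h.1
        rw [hχ, if_neg hne, add_zero, hx.1.chi_zero i' j' he]
      · intro i' j' _
        rw [hχ]
        split_ifs with hij
        · rw [hij.1, hij.2]
          exact htχ.le
        · simpa using hx.1.chi_nonneg' i' j'
    have hle := hx.2 y hy
    simp only [fluidObjective, y] at hle
    rw [Fintype.sum_apply_update (fun j a => M.F j a * a),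
      Fintype.sum_apply_update (fun i a => M.G i a * a)] at hle
    simp only [f, add_zero]
    linarith
  exact sub_eq_zero.1 (hmax.hasDerivAt_eq_zero hf)

/-- By balance of flow, rates weighted by potentials that agree along the flow cancel. -/
theorem FluidFeasible.sum_mul_lam_eq (hx : M.FluidFeasible x) {κ : Fin m → ℝ} {κ' : Fin n → ℝ}
    (hκ : ∀ i j, (i, j) ∈ M.fluidSupport x → κ j = κ' i) :
    ∑ j, κ j * x.lam j = ∑ i, κ' i * x.mu i := by
  simp only [hx.lam_eq, hx.mu_eq, Finset.mul_sum]
  rw [Finset.sum_comm]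
  refine Finset.sum_congr rfl fun i _ => Finset.sum_congr rfl fun j _ => ?_
  by_cases h : x.chi i j = 0
  · rw [h, mul_zero, mul_zero]
  · rw [hκ i j (hx.mem_fluidSupport h)]

end TwoSidedQueue

/-! ### Expansion of the curves around the fluid rates -/

theorem ContDiffAt.exists_abs_sub_linear_le {f : ℝ → ℝ} {a : ℝ} (hf : ContDiffAt ℝ 2 f a) :
    ∃ C, 0 ≤ C ∧ ∀ᶠ u in 𝓝 (0 : ℝ), |f (a + u) - f a - deriv f a * u| ≤ C * u ^ 2 := by
  have hd : ContDiffAt ℝ 1 (deriv f) a := ContDiffAt.derivWithin hf (by norm_num)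
  obtain ⟨C, hC, hbd⟩ :=
    (hd.differentiableAt one_ne_zero).hasDerivAt.isBigO_sub.exists_nonneg
  obtain ⟨δ, hδ, hball⟩ := Metric.eventually_nhds_iff_ball.1
    (hbd.bound.and (hf.eventually (by simp)))
  refine ⟨C, hC, ?_⟩
  filter_upwards [Metric.ball_mem_nhds (0 : ℝ) hδ] with u hu
  have hu' : |u| < δ := by simpa using hu
  have hseg : ∀ y ∈ Set.uIcc a (a + u), |y - a| ≤ |u| := fun y hy => by
    simpa using Set.abs_sub_left_of_mem_uIcc hy
  have hmem : ∀ y ∈ Set.uIcc a (a + u), y ∈ Metric.ball a δ := fun y hy => by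
    rw [Metric.mem_ball, Real.dist_eq]
    exact (hseg y hy).trans_lt hu'
  have h := (convex_uIcc a (a + u)).norm_image_sub_le_of_norm_hasDerivWithin_le
    (f := fun y => f y - deriv f a * y) (f' := fun y => deriv f y - deriv f a * 1) (C := C * |u|)
    (fun y hy => ((((hball y (hmem y hy)).2.differentiableAt (by norm_num)).hasDerivAt.sub
      ((hasDerivAt_id y).const_mul _))).hasDerivWithinAt)
    (fun y hy => by
      have h1 := (hball y (hmem y hy)).1
      rw [Real.norm_eq_abs, Real.norm_eq_abs] at h1
      rw [mul_one, Real.norm_eq_abs]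
      exact h1.trans (mul_le_mul_of_nonneg_left (hseg y hy) hC))
    Set.left_mem_uIcc Set.right_mem_uIcc
  rw [Real.norm_eq_abs, add_sub_cancel_left, Real.norm_eq_abs, mul_assoc, abs_mul_abs_self] at h
  rw [sq]
  convert h using 2
  ring

theorem natCast_rpow_mul_rpow_third (η : ℕ) :
    (η : ℝ) ^ (2 / 3 : ℝ) * (η : ℝ) ^ (1 / 3 : ℝ) = η := by
  rw [← Real.rpow_add_of_nonneg (Nat.cast_nonneg η) (by norm_num) (by norm_num)]
  norm_num

theorem natCast_rpow_two_thirds (η : ℕ) :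
    (η : ℝ) ^ (2 / 3 : ℝ) = (η : ℝ) ^ (1 / 3 : ℝ) * (η : ℝ) ^ (1 / 3 : ℝ) := by
  rw [← Real.rpow_add_of_nonneg (Nat.cast_nonneg η) (by norm_num) (by norm_num)]
  norm_num

theorem tendsto_natCast_rpow_third :
    Tendsto (fun η : ℕ => (η : ℝ) ^ (1 / 3 : ℝ)) atTop atTop :=
  (tendsto_rpow_atTop (by norm_num)).comp tendsto_natCast_atTop_atTop

/-- Relative to `η`, the two rates differ by a multiple of `η ^ (-1 / 3)`. -/
theorem exists_twoPriceRate_eq (T₁ : ℝ) {η : ℕ} (hη : 0 < η) (a d : ℝ) (len : ℕ) :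
    ∃ u, (u = 0 ∨ u = -d / (η : ℝ) ^ (1 / 3 : ℝ)) ∧ twoPriceRate T₁ η a d len = η * (a + u) := by
  have hη' : (0 : ℝ) < η := by exact_mod_cast hη
  unfold twoPriceRate
  split_ifs
  · exact ⟨0, Or.inl rfl, by rw [add_zero]⟩
  · refine ⟨_, Or.inr rfl, ?_⟩
    have h : (0 : ℝ) < (η : ℝ) ^ (1 / 3 : ℝ) := by positivity
    have h2 : η * (-d / (η : ℝ) ^ (1 / 3 : ℝ)) = -d * (η : ℝ) ^ (2 / 3 : ℝ) := by
      rw [← mul_div_assoc, div_eq_iff h.ne', mul_assoc, natCast_rpow_mul_rpow_third]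
      ring
    rw [mul_add, h2]
    ring

theorem eventually_of_nhds_twoPriceRate {P : ℝ → Prop} (hP : ∀ᶠ u in 𝓝 0, P u) (d : ℝ) :
    ∀ᶠ η : ℕ in atTop, ∀ u, (u = 0 ∨ u = -d / (η : ℝ) ^ (1 / 3 : ℝ)) → P u := by
  have h : Tendsto (fun η : ℕ => -d / (η : ℝ) ^ (1 / 3 : ℝ)) atTop (𝓝 0) :=
    tendsto_natCast_rpow_third.const_div_atTop (-d)
  filter_upwards [h.eventually hP] with η hη
  rintro u (rfl | rfl)
  · exact hP.self_of_nhds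
  · exact hη

/-- The rates are eventually nonnegative and, relative to `η`, in the domain of the curve. Queues
of a type with fluid rate zero stay empty, so that only length zero matters for them. -/
theorem eventually_twoPriceRate_mem {D : Set ℝ} {a : ℝ} (hD : D ⊆ Set.Ici 0) (haD : a ∈ D)
    (ha : a = 0 ∨ a ∈ interior D) {T₁ : ℝ} (hT₁ : 0 < T₁) (d : ℝ) :
    ∀ᶠ η : ℕ in atTop, ∀ len : ℕ, (a = 0 → len = 0) →
      0 ≤ twoPriceRate T₁ η a d len ∧ twoPriceRate T₁ η a d len / η ∈ D := by
  rcases ha with rfl | ha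
  · refine Eventually.of_forall fun η len hlen => ?_
    have h0 : twoPriceRate T₁ η 0 d len = 0 := by
      have : (0 : ℝ) ≤ T₁ * (η : ℝ) ^ (1 / 3 : ℝ) := by positivity
      rw [hlen rfl, twoPriceRate, Nat.cast_zero, if_pos this, mul_zero]
    rw [h0, zero_div]
    exact ⟨le_rfl, haD⟩
  · have hP : ∀ᶠ u in 𝓝 (0 : ℝ), a + u ∈ D := by
      have h : Tendsto (fun u => a + u) (𝓝 (0 : ℝ)) (𝓝 a) := by
        simpa using (tendsto_id (x := 𝓝 (0 : ℝ))).const_add a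
      exact h.eventually (mem_interior_iff_mem_nhds.1 ha)
    filter_upwards [eventually_of_nhds_twoPriceRate hP d, eventually_gt_atTop 0] with η hη hpos len _
    have hη' : (0 : ℝ) < η := by exact_mod_cast hpos
    obtain ⟨u, hu, heq⟩ := exists_twoPriceRate_eq T₁ hpos a d len
    rw [heq, mul_div_cancel_left₀ _ hη'.ne']
    exact ⟨mul_nonneg hη'.le (hD (hη u hu)), hη u hu⟩

/-- Second-order expansion of the revenue or cost rate `y * F y`: the price perturbation
`η ^ (-1 / 3)`, squared and multiplied by `η`, leaves an error of order `η ^ (1 / 3)`. -/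
theorem exists_twoPriceRate_expansion {D : Set ℝ} {F : ℝ → ℝ} (hF : ContDiffOn ℝ 2 F D) {a : ℝ}
    (ha : a = 0 ∨ a ∈ interior D) {T₁ : ℝ} (hT₁ : 0 < T₁) (d : ℝ) :
    ∃ C, ∀ᶠ η : ℕ in atTop, ∀ len : ℕ, (a = 0 → len = 0) →
      |F (twoPriceRate T₁ η a d len / η) * twoPriceRate T₁ η a d len - η * (F a * a) -
        deriv (fun y => y * F y) a * (twoPriceRate T₁ η a d len - η * a)| ≤
      C * (η : ℝ) ^ (1 / 3 : ℝ) := by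
  rcases ha with rfl | ha
  · refine ⟨0, Eventually.of_forall fun η len hlen => ?_⟩
    have h0 : twoPriceRate T₁ η 0 d len = 0 := by
      have : (0 : ℝ) ≤ T₁ * (η : ℝ) ^ (1 / 3 : ℝ) := by positivity
      rw [hlen rfl, twoPriceRate, Nat.cast_zero, if_pos this, mul_zero]
    simp [h0]
  · have hf : ContDiffAt ℝ 2 (fun y => y * F y) a :=
      contDiffAt_id.mul (hF.contDiffAt (mem_interior_iff_mem_nhds.1 ha))
    obtain ⟨C, hC, hbd⟩ := hf.exists_abs_sub_linear_le
    refine ⟨C * d ^ 2, ?_⟩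
    filter_upwards [eventually_of_nhds_twoPriceRate hbd d, eventually_gt_atTop 0]
      with η hη hpos len _
    have hη' : (0 : ℝ) < η := by exact_mod_cast hpos
    obtain ⟨u, hu, heq⟩ := exists_twoPriceRate_eq T₁ hpos a d len
    have h1 := hη u hu
    have hsq : η * u ^ 2 ≤ d ^ 2 * (η : ℝ) ^ (1 / 3 : ℝ) := by
      have hy : (0 : ℝ) < (η : ℝ) ^ (1 / 3 : ℝ) := by positivity
      rcases hu with rfl | rfl
      · simp only [ne_eq, OfNat.ofNat_ne_zero, not_false_eq_true, zero_pow, mul_zero]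
        positivity
      · have hcube := natCast_rpow_mul_rpow_third η
        rw [natCast_rpow_two_thirds] at hcube
        set y := (η : ℝ) ^ (1 / 3 : ℝ)
        rw [← hcube]
        field_simp
        exact le_rfl
    rw [heq, mul_div_cancel_left₀ _ hη'.ne']
    have h2 : F (a + u) * (η * (a + u)) - η * (F a * a) -
        deriv (fun y => y * F y) a * (η * (a + u) - η * a) =
        η * ((a + u) * F (a + u) - a * F a - deriv (fun y => y * F y) a * u) := by ring
    rw [h2, abs_mul, abs_of_pos hη']
    calc _ ≤ η * (C * u ^ 2) := mul_le_mul_of_nonneg_left h1 hη'.le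
      _ = C * (η * u ^ 2) := by ring
      _ ≤ C * (d ^ 2 * (η : ℝ) ^ (1 / 3 : ℝ)) := mul_le_mul_of_nonneg_left hsq hC
      _ = _ := by ring

/-! ### Drift of the queues under max-weight matching -/

namespace TwoSidedQueue

variable {n m : ℕ}

/-- The states in which no two compatible queues are both nonempty and in which queues of types
with fluid rate zero are empty. -/
def matchedStates (M : TwoSidedQueue n m) (x : FluidPoint n m) : Set (QueueState n m) :=
  {q | (∀ i j, (i, j) ∈ M.fluidSupport x → q.1 i = 0 ∨ q.2 j = 0) ∧
    (∀ j, x.lam j = 0 → q.2 j = 0) ∧ ∀ i, x.mu i = 0 → q.1 i = 0}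

end TwoSidedQueue

namespace QueueState

variable {n m : ℕ}

/-- The number of waiting servers and customers. -/
def total (q : QueueState n m) : ℕ := ∑ i, q.1 i + ∑ j, q.2 j

/-- The quadratic Lyapunov function of max-weight matching. -/
def sumSq (q : QueueState n m) : ℝ := ∑ i, (q.1 i : ℝ) ^ 2 + ∑ j, (q.2 j : ℝ) ^ 2

/-- The imbalance between waiting customers and servers, weighted by prices `κ` and `κ'`. If the
prices agree along the edges used for matching, every customer of type `j` changes it by `κ j` and
every server of type `i` by `-κ' i`, whether matched or not. -/
def imbalance (κ : Fin m → ℝ) (κ' : Fin n → ℝ) (q : QueueState n m) : ℝ :=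
  ∑ j, κ j * q.2 j - ∑ i, κ' i * q.1 i

theorem le_total_fst (q : QueueState n m) (i : Fin n) : q.1 i ≤ total q :=
  (Finset.single_le_sum (f := q.1) (fun _ _ => Nat.zero_le _) (Finset.mem_univ i)).trans
    (Nat.le_add_right _ _)

theorem le_total_snd (q : QueueState n m) (j : Fin m) : q.2 j ≤ total q :=
  (Finset.single_le_sum (f := q.2) (fun _ _ => Nat.zero_le _) (Finset.mem_univ j)).trans
    (Nat.le_add_left _ _)

theorem cast_total (q : QueueState n m) :
    (total q : ℝ) = ∑ i, (q.1 i : ℝ) + ∑ j, (q.2 j : ℝ) := by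
  simp [total]

end QueueState

theorem Fintype.sum_update_pred_lt {ι : Type*} [Fintype ι] [DecidableEq ι] (f : ι → ℕ) {k : ι}
    (hk : 0 < f k) : ∑ i, Function.update f k (f k - 1) i < ∑ i, f i := by
  refine Finset.sum_lt_sum (fun i _ => ?_) ⟨k, Finset.mem_univ k, ?_⟩
  · rcases eq_or_ne i k with rfl | h
    · simp
    · simp [h]
  · simp only [Function.update_self]
    omega

namespace MatchingRule

open QueueState

variable {n m : ℕ} {r : MatchingRule n m} {E : Set (Fin n × Fin m)}

theorem next_inl_some {q : QueueState n m} {i : Fin n} {j : Fin m} (h : r.onServer q i = some j) :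
    r.next q (some (Sum.inl i)) = (q.1, Function.update q.2 j (q.2 j - 1)) := by
  simp only [next, h]

theorem next_inl_none {q : QueueState n m} {i : Fin n} (h : r.onServer q i = none) :
    r.next q (some (Sum.inl i)) = (Function.update q.1 i (q.1 i + 1), q.2) := by
  simp only [next, h]

theorem next_inr_some {q : QueueState n m} {i : Fin n} {j : Fin m}
    (h : r.onCustomer q j = some i) :
    r.next q (some (Sum.inr j)) = (Function.update q.1 i (q.1 i - 1), q.2) := by
  simp only [next, h]

theorem next_inr_none {q : QueueState n m} {j : Fin m} (h : r.onCustomer q j = none) :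
    r.next q (some (Sum.inr j)) = (q.1, Function.update q.2 j (q.2 j + 1)) := by
  simp only [next, h]

theorem IsMaxWeight.imbalance_inl (hr : r.IsMaxWeight E) {κ : Fin m → ℝ} {κ' : Fin n → ℝ}
    (hκ : ∀ i j, (i, j) ∈ E → κ j = κ' i) (q : QueueState n m) (i : Fin n) :
    imbalance κ κ' (r.next q (some (Sum.inl i))) - imbalance κ κ' q = -κ' i := by
  rcases h : r.onServer q i with _ | j
  · rw [next_inl_none h]
    simp only [imbalance, Fintype.sum_apply_update (fun i (a : ℕ) => κ' i * (a : ℝ))]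
    push_cast
    ring
  · obtain ⟨he, hpos, -⟩ := hr.onServer_some q i j h
    rw [next_inl_some h]
    simp only [imbalance, Fintype.sum_apply_update (fun j (a : ℕ) => κ j * (a : ℝ))]
    rw [Nat.cast_pred hpos, hκ i j he]
    ring

theorem IsMaxWeight.imbalance_inr (hr : r.IsMaxWeight E) {κ : Fin m → ℝ} {κ' : Fin n → ℝ}
    (hκ : ∀ i j, (i, j) ∈ E → κ j = κ' i) (q : QueueState n m) (j : Fin m) :
    imbalance κ κ' (r.next q (some (Sum.inr j))) - imbalance κ κ' q = κ j := by
  rcases h : r.onCustomer q j with _ | i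
  · rw [next_inr_none h]
    simp only [imbalance, Fintype.sum_apply_update (fun j (a : ℕ) => κ j * (a : ℝ))]
    push_cast
    ring
  · obtain ⟨he, hpos, -⟩ := hr.onCustomer_some q j i h
    rw [next_inr_some h]
    simp only [imbalance, Fintype.sum_apply_update (fun i (a : ℕ) => κ' i * (a : ℝ))]
    rw [Nat.cast_pred hpos, hκ i j he]
    ring

/-- Effect of a server on the Lyapunov function. If the server is matched, it was alone, hence
arrived at the full rate `w`, and the longest compatible queue, which it shortens, dominates the
average of the compatible queues that the fluid solution would serve. -/
theorem IsMaxWeight.mul_sumSq_inl_le (hr : r.IsMaxWeight E) {q : QueueState n m} {i : Fin n}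
    (hq : ∀ j, (i, j) ∈ E → q.1 i = 0 ∨ q.2 j = 0) {v w : ℝ} {c : Fin m → ℝ}
    (hv : q.1 i = 0 → v = w) (hc : ∀ j, 0 ≤ c j) (hcE : ∀ j, c j ≠ 0 → (i, j) ∈ E)
    (hw : w = ∑ j, c j) :
    v * (sumSq (r.next q (some (Sum.inl i))) - sumSq q) ≤
      v * (1 + 2 * q.1 i) - 2 * ∑ j, c j * q.2 j := by
  rcases h : r.onServer q i with _ | j
  · have h0 : ∑ j, c j * (q.2 j : ℝ) = 0 := Finset.sum_eq_zero fun j _ => by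
      by_cases hj : c j = 0
      · rw [hj, zero_mul]
      · rw [hr.onServer_none q i h j (hcE j hj), Nat.cast_zero, mul_zero]
    rw [next_inl_none h, h0]
    simp only [sumSq, Fintype.sum_apply_update (fun _ (a : ℕ) => (a : ℝ) ^ 2)]
    push_cast
    exact le_of_eq (by ring)
  · obtain ⟨he, hpos, hmax⟩ := hr.onServer_some q i j h
    have hi : q.1 i = 0 := (hq j he).resolve_right hpos.ne'
    have h1 : ∑ j', c j' * (q.2 j' : ℝ) ≤ w * q.2 j := by
      rw [hw, Finset.sum_mul]
      refine Finset.sum_le_sum fun j' _ => ?_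
      by_cases hj : c j' = 0
      · rw [hj, zero_mul, zero_mul]
      · exact mul_le_mul_of_nonneg_left (by exact_mod_cast hmax j' (hcE j' hj)) (hc j')
    rw [next_inl_some h, hi, hv hi]
    simp only [sumSq, Fintype.sum_apply_update (fun _ (a : ℕ) => (a : ℝ) ^ 2)]
    rw [Nat.cast_pred hpos]
    push_cast
    linarith

theorem IsMaxWeight.mul_sumSq_inr_le (hr : r.IsMaxWeight E) {q : QueueState n m} {j : Fin m}
    (hq : ∀ i, (i, j) ∈ E → q.1 i = 0 ∨ q.2 j = 0) {v w : ℝ} {c : Fin n → ℝ}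
    (hv : q.2 j = 0 → v = w) (hc : ∀ i, 0 ≤ c i) (hcE : ∀ i, c i ≠ 0 → (i, j) ∈ E)
    (hw : w = ∑ i, c i) :
    v * (sumSq (r.next q (some (Sum.inr j))) - sumSq q) ≤
      v * (1 + 2 * q.2 j) - 2 * ∑ i, c i * q.1 i := by
  rcases h : r.onCustomer q j with _ | i
  · have h0 : ∑ i, c i * (q.1 i : ℝ) = 0 := Finset.sum_eq_zero fun i _ => by
      by_cases hi : c i = 0
      · rw [hi, zero_mul]
      · rw [hr.onCustomer_none q j h i (hcE i hi), Nat.cast_zero, mul_zero]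
    rw [next_inr_none h, h0]
    simp only [sumSq, Fintype.sum_apply_update (fun _ (a : ℕ) => (a : ℝ) ^ 2)]
    push_cast
    exact le_of_eq (by ring)
  · obtain ⟨he, hpos, hmax⟩ := hr.onCustomer_some q j i h
    have hj : q.2 j = 0 := (hq i he).resolve_left hpos.ne'
    have h1 : ∑ i', c i' * (q.1 i' : ℝ) ≤ w * q.1 i := by
      rw [hw, Finset.sum_mul]
      refine Finset.sum_le_sum fun i' _ => ?_
      by_cases hi : c i' = 0
      · rw [hi, zero_mul, zero_mul]
      · exact mul_le_mul_of_nonneg_left (by exact_mod_cast hmax i' (hcE i' hi)) (hc i')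
    rw [next_inr_some h, hj, hv hj]
    simp only [sumSq, Fintype.sum_apply_update (fun _ (a : ℕ) => (a : ℝ) ^ 2)]
    rw [Nat.cast_pred hpos]
    push_cast
    linarith

end MatchingRule

namespace ArrivalRates

variable {n m : ℕ}

theorem cap_mul_op_sub (a : ArrivalRates n m) (r : MatchingRule n m) (f : QueueState n m → ℝ)
    (q : QueueState n m) :
    (a.cap : ℝ) * ((a.eventChain r).op f q - f q) =
      ∑ i, (a.server q i : ℝ) * (f (r.next q (some (Sum.inl i))) - f q) +
        ∑ j, (a.customer q j : ℝ) * (f (r.next q (some (Sum.inr j))) - f q) := by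
  have hcap : (a.cap : ℝ) ≠ 0 := by exact_mod_cast a.cap_pos.ne'
  rw [EventChain.op_sub_self, Fintype.sum_option, Fintype.sum_sum_type]
  simp only [eventChain, eventProb, MatchingRule.next, sub_self, mul_zero, zero_add, mul_add,
    Finset.mul_sum, NNReal.coe_div]
  congr 1 <;> refine Finset.sum_congr rfl fun _ _ => ?_ <;> field_simp

theorem cap_mul_op_imbalance_sub {a : ArrivalRates n m} {r : MatchingRule n m}
    {E : Set (Fin n × Fin m)} (hr : r.IsMaxWeight E) {κ : Fin m → ℝ} {κ' : Fin n → ℝ}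
    (hκ : ∀ i j, (i, j) ∈ E → κ j = κ' i) (q : QueueState n m) :
    (a.cap : ℝ) * ((a.eventChain r).op (QueueState.imbalance κ κ') q -
      QueueState.imbalance κ κ' q) =
      ∑ j, κ j * a.customer q j - ∑ i, κ' i * a.server q i := by
  rw [cap_mul_op_sub]
  simp only [hr.imbalance_inl hκ, hr.imbalance_inr hκ, mul_neg, Finset.sum_neg_distrib]
  simp only [mul_comm]
  ring

end ArrivalRates

/-- The reduced rate yields a drift proportional to the excess of the queue over the threshold. -/
theorem two_mul_twoPriceRate_sub_le {T₁ : ℝ} {η : ℕ} {a d ψ : ℝ} (hψ : 0 ≤ ψ) (hd : ψ ≤ d)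
    (hT₁ : 0 ≤ T₁) (len : ℕ) :
    2 * len * (twoPriceRate T₁ η a d len - η * a) ≤
      2 * ψ * T₁ * η - 2 * ψ * (η : ℝ) ^ (2 / 3 : ℝ) * len := by
  have hcube := natCast_rpow_mul_rpow_third η
  have hz : (0 : ℝ) ≤ (η : ℝ) ^ (2 / 3 : ℝ) := by positivity
  have hlen : (0 : ℝ) ≤ len := Nat.cast_nonneg _
  have h1 : 2 * ψ * T₁ * η = 2 * ψ * (η : ℝ) ^ (2 / 3 : ℝ) * (T₁ * (η : ℝ) ^ (1 / 3 : ℝ)) := by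
    conv_lhs => rw [← hcube]
    ring
  unfold twoPriceRate
  split_ifs with h
  · have := mul_le_mul_of_nonneg_left h (show 0 ≤ 2 * ψ * (η : ℝ) ^ (2 / 3 : ℝ) by positivity)
    rw [sub_self, mul_zero]
    linarith
  · have h2 : 0 ≤ 2 * ψ * T₁ * η := by positivity
    have h3 : 2 * ψ * (η : ℝ) ^ (2 / 3 : ℝ) * len ≤ 2 * d * (η : ℝ) ^ (2 / 3 : ℝ) * len := by
      gcongr
    linarith

theorem Finite.exists_pos_le {ι : Type*} [Finite ι] (f : ι → ℝ) :
    ∃ δ > 0, ∀ i, 0 < f i → δ ≤ f i := by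
  have h : ∀ᶠ δ in 𝓝[>] (0 : ℝ), ∀ i, 0 < f i → δ ≤ f i :=
    eventually_all.2 fun i => eventually_imp_distrib_left.2 fun hi =>
      mem_nhdsWithin_of_mem_nhds (Iic_mem_nhds hi)
  obtain ⟨δ, hδ, hpos⟩ := (h.and self_mem_nhdsWithin).exists
  exact ⟨δ, hpos, hδ⟩

/-! ### The two-price policy -/

namespace TwoSidedQueue

open QueueState

variable {n m : ℕ} {M : TwoSidedQueue n m} {x : FluidPoint n m} {T₁ : ℝ} {θ : Fin m → ℝ≥0}
  {φ : Fin n → ℝ≥0} {η : ℕ} {r : MatchingRule n m}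

theorem zero_mem_matchedStates : (0 : QueueState n m) ∈ M.matchedStates x :=
  ⟨fun _ _ _ => Or.inl rfl, fun _ _ => rfl, fun _ _ => rfl⟩

theorem twoPriceRate_zero_len (hT₁ : 0 < T₁) (a d : ℝ) : twoPriceRate T₁ η a d 0 = η * a := by
  have : (0 : ℝ) ≤ T₁ * (η : ℝ) ^ (1 / 3 : ℝ) := by positivity
  rw [twoPriceRate, Nat.cast_zero, if_pos this]

theorem closed_matchedStates (hT₁ : 0 < T₁) (hr : r.IsMaxWeight (M.fluidSupport x)) :
    ((twoPricePolicy x T₁ θ φ η).eventChain r).Closed (M.matchedStates x) := by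
  rintro q ⟨hE, hl, hm⟩ e he
  change 0 < ((twoPricePolicy x T₁ θ φ η).eventProb q e : ℝ) at he
  change r.next q e ∈ M.matchedStates x
  rcases e with _ | i | j
  · exact ⟨hE, hl, hm⟩
  · rcases h : r.onServer q i with _ | j
    · rw [MatchingRule.next_inl_none h]
      refine ⟨fun i' j' he' => ?_, hl, fun i' hi' => ?_⟩
      · rcases eq_or_ne i' i with rfl | hne
        · exact Or.inr (hr.onServer_none q i' h j' he')
        · simpa [hne] using hE i' j' he'
      · rcases eq_or_ne i' i with rfl | hne
        · -- servers of this type do not arrive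
          simp [ArrivalRates.eventProb, twoPricePolicy, hm i' hi', hi',
            twoPriceRate_zero_len hT₁] at he
        · simpa [hne] using hm i' hi'
    · rw [MatchingRule.next_inl_some h]
      have hz : ∀ j', q.2 j' = 0 → Function.update q.2 j (q.2 j - 1) j' = 0 := by
        intro j' hj'
        rcases eq_or_ne j' j with rfl | hne
        · simp [hj']
        · simpa [hne] using hj'
      exact ⟨fun i' j' he' => (hE i' j' he').imp_right (hz j'), fun j' hj' => hz j' (hl j' hj'), hm⟩
  · rcases h : r.onCustomer q j with _ | i
    · rw [MatchingRule.next_inr_none h]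
      refine ⟨fun i' j' he' => ?_, fun j' hj' => ?_, hm⟩
      · rcases eq_or_ne j' j with rfl | hne
        · exact Or.inl (hr.onCustomer_none q j' h i' he')
        · simpa [hne] using hE i' j' he'
      · rcases eq_or_ne j' j with rfl | hne
        · simp [ArrivalRates.eventProb, twoPricePolicy, hl j' hj', hj',
            twoPriceRate_zero_len hT₁] at he
        · simpa [hne] using hl j' hj'
    · rw [MatchingRule.next_inr_some h]
      have hz : ∀ i', q.1 i' = 0 → Function.update q.1 i (q.1 i - 1) i' = 0 := by
        intro i' hi'
        rcases eq_or_ne i' i with rfl | hne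
        · simp [hi']
        · simpa [hne] using hi'
      exact ⟨fun i' j' he' => (hE i' j' he').imp_left (hz i'), hl, fun i' hi' => hz i' (hm i' hi')⟩

/-- In the states of `S` the formulas for the two-price rates are nonnegative, so that the policy
uses them without truncation. -/
def UntruncatedOn (x : FluidPoint n m) (T₁ : ℝ) (θ : Fin m → ℝ≥0) (φ : Fin n → ℝ≥0) (η : ℕ)
    (S : Set (QueueState n m)) : Prop :=
  ∀ q ∈ S, (∀ j, 0 ≤ twoPriceRate T₁ η (x.lam j) (θ j) (q.2 j)) ∧
    ∀ i, 0 ≤ twoPriceRate T₁ η (x.mu i) (φ i) (q.1 i)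

theorem UntruncatedOn.coe_customer {S : Set (QueueState n m)} (h : UntruncatedOn x T₁ θ φ η S)
    {q : QueueState n m} (hq : q ∈ S) (j : Fin m) :
    ((twoPricePolicy x T₁ θ φ η).customer q j : ℝ) = twoPriceRate T₁ η (x.lam j) (θ j) (q.2 j) :=
  Real.coe_toNNReal _ ((h q hq).1 j)

theorem UntruncatedOn.coe_server {S : Set (QueueState n m)} (h : UntruncatedOn x T₁ θ φ η S)
    {q : QueueState n m} (hq : q ∈ S) (i : Fin n) :
    ((twoPricePolicy x T₁ θ φ η).server q i : ℝ) = twoPriceRate T₁ η (x.mu i) (φ i) (q.1 i) :=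
  Real.coe_toNNReal _ ((h q hq).2 i)

theorem twoPriceRate_le (a : ℝ) (d : ℝ≥0) (len : ℕ) : twoPriceRate T₁ η a d len ≤ η * a := by
  unfold twoPriceRate
  split_ifs
  · exact le_rfl
  · have : 0 ≤ (d : ℝ) * (η : ℝ) ^ (2 / 3 : ℝ) := by positivity
    linarith

theorem cap_mul_op_sumSq_sub_le (hx : M.FluidFeasible x) (hT₁ : 0 < T₁)
    (hr : r.IsMaxWeight (M.fluidSupport x)) {ψ : ℝ} (hψ : 0 ≤ ψ) (hθ : ∀ j, ψ ≤ θ j)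
    (hφ : ∀ i, ψ ≤ φ i) (hU : UntruncatedOn x T₁ θ φ η (M.matchedStates x))
    {q : QueueState n m} (hq : q ∈ M.matchedStates x) :
    ((twoPricePolicy x T₁ θ φ η).cap : ℝ) *
        (((twoPricePolicy x T₁ θ φ η).eventChain r).op sumSq q - sumSq q) ≤
      η * (∑ i, x.mu i + ∑ j, x.lam j + (n + m) * (2 * ψ * T₁)) -
        2 * ψ * (η : ℝ) ^ (2 / 3 : ℝ) * total q := by
  have hserver : ∀ i, ((twoPricePolicy x T₁ θ φ η).server q i : ℝ) *
      (sumSq (r.next q (some (Sum.inl i))) - sumSq q) ≤ (η * x.mu i + 2 * ψ * T₁ * η -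
        2 * ψ * (η : ℝ) ^ (2 / 3 : ℝ) * q.1 i) + 2 * (η * x.mu i * q.1 i) -
        2 * ∑ j, η * x.chi i j * q.2 j := by
    intro i
    rw [hU.coe_server hq]
    refine (hr.mul_sumSq_inl_le (w := η * x.mu i) (c := fun j => η * x.chi i j)
      (fun j he => hq.1 i j he) (fun h0 => by rw [h0, twoPriceRate_zero_len hT₁])
      (fun j => mul_nonneg (Nat.cast_nonneg _) (hx.chi_nonneg' i j))
      (fun j hj => hx.mem_fluidSupport (right_ne_zero_of_mul hj))
      (by rw [hx.mu_eq, Finset.mul_sum])).trans ?_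
    have h1 := two_mul_twoPriceRate_sub_le (η := η) (a := x.mu i) hψ (hφ i) hT₁.le (q.1 i)
    have h2 := twoPriceRate_le (T₁ := T₁) (η := η) (x.mu i) (φ i) (q.1 i)
    linarith
  have hcustomer : ∀ j, ((twoPricePolicy x T₁ θ φ η).customer q j : ℝ) *
      (sumSq (r.next q (some (Sum.inr j))) - sumSq q) ≤ (η * x.lam j + 2 * ψ * T₁ * η -
        2 * ψ * (η : ℝ) ^ (2 / 3 : ℝ) * q.2 j) + 2 * (η * x.lam j * q.2 j) -
        2 * ∑ i, η * x.chi i j * q.1 i := by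
    intro j
    rw [hU.coe_customer hq]
    refine (hr.mul_sumSq_inr_le (w := η * x.lam j) (c := fun i => η * x.chi i j)
      (fun i he => hq.1 i j he) (fun h0 => by rw [h0, twoPriceRate_zero_len hT₁])
      (fun i => mul_nonneg (Nat.cast_nonneg _) (hx.chi_nonneg' i j))
      (fun i hi => hx.mem_fluidSupport (right_ne_zero_of_mul hi))
      (by rw [hx.lam_eq, Finset.mul_sum])).trans ?_
    have h1 := two_mul_twoPriceRate_sub_le (η := η) (a := x.lam j) hψ (hθ j) hT₁.le (q.2 j)
    have h2 := twoPriceRate_le (T₁ := T₁) (η := η) (x.lam j) (θ j) (q.2 j)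
    linarith
  -- matched flow along the edges removes exactly what arrives at the full rates
  have hflow₂ : ∑ i, ∑ j, η * x.chi i j * (q.2 j : ℝ) = ∑ j, η * x.lam j * q.2 j := by
    rw [Finset.sum_comm]
    simp only [hx.lam_eq, Finset.mul_sum, Finset.sum_mul]
  have hflow₁ : ∑ j, ∑ i, η * x.chi i j * (q.1 i : ℝ) = ∑ i, η * x.mu i * q.1 i := by
    rw [Finset.sum_comm]
    simp only [hx.mu_eq, Finset.mul_sum, Finset.sum_mul]
  rw [ArrivalRates.cap_mul_op_sub]
  refine (add_le_add (Finset.sum_le_sum fun i _ => hserver i)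
    (Finset.sum_le_sum fun j _ => hcustomer j)).trans_eq ?_
  simp only [Finset.sum_add_distrib, Finset.sum_sub_distrib, ← Finset.mul_sum, hflow₁, hflow₂,
    Finset.sum_const, Finset.card_univ, Fintype.card_fin, nsmul_eq_mul, cast_total]
  ring

/-- A waiting agent has a compatible type whose own queue is empty and which arrives at a positive
rate; such an arrival shortens some queue. -/
theorem exists_event_total_lt (hx : M.FluidFeasible x) (hT₁ : 0 < T₁)
    (hr : r.IsMaxWeight (M.fluidSupport x)) (hη : 0 < η) {δ : ℝ}
    (hδl : ∀ j, 0 < x.lam j → δ ≤ x.lam j) (hδm : ∀ i, 0 < x.mu i → δ ≤ x.mu i)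
    {q : QueueState n m} (hq : q ∈ M.matchedStates x) (hN : 0 < total q) :
    ∃ e, η * δ / (twoPricePolicy x T₁ θ φ η).cap ≤
        ((twoPricePolicy x T₁ θ φ η).eventChain r).prob q e ∧ total (r.next q e) < total q := by
  have hex : (∃ i, 0 < q.1 i) ∨ ∃ j, 0 < q.2 j := by
    by_contra! h
    have h1 : total q = 0 := by
      simp only [total]
      rw [Finset.sum_eq_zero fun i _ => Nat.le_zero.1 (h.1 i),
        Finset.sum_eq_zero fun j _ => Nat.le_zero.1 (h.2 j), add_zero]
    omega
  rcases hex with ⟨i, hi⟩ | ⟨j, hj⟩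
  · obtain ⟨j, he⟩ := hx.exists_customer fun h0 => hi.ne' (hq.2.2 i h0)
    have hj : q.2 j = 0 := (hq.1 i j he).resolve_left hi.ne'
    refine ⟨some (Sum.inr j), ?_, ?_⟩
    · change _ ≤ (((twoPricePolicy x T₁ θ φ η).customer q j /
        (twoPricePolicy x T₁ θ φ η).cap : ℝ≥0) : ℝ)
      rw [NNReal.coe_div]
      gcongr
      refine le_trans ?_ (Real.le_coe_toNNReal _)
      rw [hj, twoPriceRate_zero_len hT₁]
      gcongr
      exact hδl j (hx.lam_pos he)
    · rcases h : r.onCustomer q j with _ | i'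
      · exact absurd (hr.onCustomer_none q j h i he) hi.ne'
      · rw [MatchingRule.next_inr_some h]
        exact Nat.add_lt_add_right
          (Fintype.sum_update_pred_lt q.1 (hr.onCustomer_some q j i' h).2.1) _
  · obtain ⟨i, he⟩ := hx.exists_server fun h0 => hj.ne' (hq.2.1 j h0)
    have hi : q.1 i = 0 := (hq.1 i j he).resolve_right hj.ne'
    refine ⟨some (Sum.inl i), ?_, ?_⟩
    · change _ ≤ (((twoPricePolicy x T₁ θ φ η).server q i /
        (twoPricePolicy x T₁ θ φ η).cap : ℝ≥0) : ℝ)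
      rw [NNReal.coe_div]
      gcongr
      refine le_trans ?_ (Real.le_coe_toNNReal _)
      rw [hi, twoPriceRate_zero_len hT₁]
      gcongr
      exact hδm i (hx.mu_pos he)
    · rcases h : r.onServer q i with _ | j'
      · exact absurd (hr.onServer_none q i h j he) hj.ne'
      · rw [MatchingRule.next_inl_some h]
        exact Nat.add_lt_add_left
          (Fintype.sum_update_pred_lt q.2 (hr.onServer_some q i j' h).2.1) _

theorem exists_drift (hx : M.FluidFeasible x) (hT₁ : 0 < T₁)
    (hr : r.IsMaxWeight (M.fluidSupport x)) {ψ : ℝ} (hψ : 0 < ψ) (hθ : ∀ j, ψ ≤ θ j)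
    (hφ : ∀ i, ψ ≤ φ i) (hη : 0 < η) (hU : UntruncatedOn x T₁ θ φ η (M.matchedStates x)) :
    ∃ p, ((twoPricePolicy x T₁ θ φ η).eventChain r).Drift (M.matchedStates x) 0 total sumSq
      (2 * ψ * (η : ℝ) ^ (2 / 3 : ℝ) / (twoPricePolicy x T₁ θ φ η).cap)
      (η * (∑ i, x.mu i + ∑ j, x.lam j + (n + m) * (2 * ψ * T₁)) /
        (twoPricePolicy x T₁ θ φ η).cap) p := by
  have hη' : (0 : ℝ) < η := by exact_mod_cast hη
  set a := twoPricePolicy x T₁ θ φ η with ha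
  have hcap : (0 : ℝ) < a.cap := by exact_mod_cast a.cap_pos
  obtain ⟨δ₁, hδ₁, hl⟩ := Finite.exists_pos_le x.lam
  obtain ⟨δ₂, hδ₂, hm⟩ := Finite.exists_pos_le x.mu
  set δ := min δ₁ δ₂ with hδ
  have hδ0 : 0 < δ := lt_min hδ₁ hδ₂
  set p := min (η * δ / a.cap) (1 / a.cap) with hp
  have hcap1 : (1 : ℝ) ≤ a.cap := by
    have : (1 : ℝ≥0) ≤ a.cap := le_self_add
    exact_mod_cast this
  refine ⟨p, ⟨closed_matchedStates hT₁ hr, zero_mem_matchedStates, ?_, ?_, by positivity,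
    by positivity, ?_, ?_, ?_, ?_⟩⟩
  · intro q _ h0
    have h1 : ∀ i, q.1 i = 0 := fun i => Nat.le_zero.1 (h0 ▸ le_total_fst q i)
    have h2 : ∀ j, q.2 j = 0 := fun j => Nat.le_zero.1 (h0 ▸ le_total_snd q j)
    exact Prod.ext (funext h1) (funext h2)
  · intro q
    unfold sumSq
    positivity
  · exact (min_le_right _ _).trans ((div_le_one hcap).2 hcap1)
  · intro q hq
    have h := cap_mul_op_sumSq_sub_le hx hT₁ hr hψ.le hθ hφ hU hq
    rw [← ha] at h
    have h2 := (le_div_iff₀' hcap).2 h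
    rw [sub_div, mul_div_right_comm (2 * ψ * (η : ℝ) ^ (2 / 3 : ℝ))] at h2
    linarith
  · intro q hq hN
    obtain ⟨e, he, hlt⟩ := exists_event_total_lt (θ := θ) (φ := φ) hx hT₁ hr hη
      (fun j hj => (min_le_left _ _).trans (hl j hj))
      (fun i hi => (min_le_right _ _).trans (hm i hi)) hq hN
    exact ⟨e, (min_le_left _ _).trans he, hlt⟩
  · -- the total rate stays below `cap - 1`, so that idle steps have positive probability
    intro q _
    refine ⟨none, (min_le_right _ _).trans ?_, rfl⟩
    change 1 / (a.cap : ℝ) ≤ ((1 - (∑ i, a.server q i + ∑ j, a.customer q j) / a.cap : ℝ≥0) : ℝ)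
    rw [NNReal.coe_sub ((div_le_one a.cap_pos).2 (a.total_le q)), NNReal.coe_one, NNReal.coe_div,
      le_sub_iff_add_le, ← add_div, div_le_one hcap]
    have h1 : 1 + (∑ i, a.server q i + ∑ j, a.customer q j) ≤ a.cap :=
      add_le_add_right (add_le_add
        (Finset.sum_le_sum fun _ _ => toNNReal_twoPriceRate_le _ _ _ _ _)
        (Finset.sum_le_sum fun _ _ => toNNReal_twoPriceRate_le _ _ _ _ _)) 1
    exact_mod_cast h1

end TwoSidedQueue

/-! ### Profit loss of the two-price policy -/

namespace TwoSidedQueue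

open QueueState

variable {n m : ℕ} {M : TwoSidedQueue n m} {x : FluidPoint n m} {T₁ : ℝ} {θ : Fin m → ℝ≥0}
  {φ : Fin n → ℝ≥0} {η : ℕ} {r : MatchingRule n m}

/-- The first-order terms of the profit loss form the drift of the imbalance, weighted by marginal
revenues and costs. -/
theorem abs_profitRate_sub_le (hx : M.FluidFeasible x) (hr : r.IsMaxWeight (M.fluidSupport x))
    {κ : Fin m → ℝ} {κ' : Fin n → ℝ} (hκ : ∀ i j, (i, j) ∈ M.fluidSupport x → κ j = κ' i)
    {εF : Fin m → ℝ} {εG : Fin n → ℝ} (hU : UntruncatedOn x T₁ θ φ η (M.matchedStates x))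
    (hF : ∀ j, ∀ len : ℕ, (x.lam j = 0 → len = 0) →
      |M.F j (twoPriceRate T₁ η (x.lam j) (θ j) len / η) * twoPriceRate T₁ η (x.lam j) (θ j) len -
        η * (M.F j (x.lam j) * x.lam j) -
        κ j * (twoPriceRate T₁ η (x.lam j) (θ j) len - η * x.lam j)| ≤ εF j)
    (hG : ∀ i, ∀ len : ℕ, (x.mu i = 0 → len = 0) →
      |M.G i (twoPriceRate T₁ η (x.mu i) (φ i) len / η) * twoPriceRate T₁ η (x.mu i) (φ i) len -
        η * (M.G i (x.mu i) * x.mu i) -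
        κ' i * (twoPriceRate T₁ η (x.mu i) (φ i) len - η * x.mu i)| ≤ εG i)
    {q : QueueState n m} (hq : q ∈ M.matchedStates x) :
    |(M.scaled η).profitRate (twoPricePolicy x T₁ θ φ η) q - (η * M.fluidObjective x +
        (twoPricePolicy x T₁ θ φ η).cap *
          (((twoPricePolicy x T₁ θ φ η).eventChain r).op (imbalance κ κ') q - imbalance κ κ' q)) +
        M.s * total q| ≤ ∑ j, εF j + ∑ i, εG i := by
  rw [ArrivalRates.cap_mul_op_imbalance_sub hr hκ, cast_total]
  simp only [profitRate, scaled, hU.coe_customer hq, hU.coe_server hq, fluidObjective]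
  have hbal := hx.sum_mul_lam_eq hκ
  refine le_trans (le_of_eq ?_) ((abs_sub _ _).trans (add_le_add
    ((Finset.abs_sum_le_sum_abs _ _).trans
      (Finset.sum_le_sum fun j _ => hF j (q.2 j) (hq.2.1 j)))
    ((Finset.abs_sum_le_sum_abs _ _).trans
      (Finset.sum_le_sum fun i _ => hG i (q.1 i) (hq.2.2 i)))))
  congr 1
  simp only [mul_sub, Finset.sum_sub_distrib, mul_left_comm _ (η : ℝ), ← Finset.mul_sum, hbal]
  ring

theorem abs_imbalance_le (κ : Fin m → ℝ) (κ' : Fin n → ℝ) (q : QueueState n m) :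
    |imbalance κ κ' q| ≤ (∑ j, |κ j| + ∑ i, |κ' i|) * (1 + total q) := by
  have h1 : |∑ j, κ j * (q.2 j : ℝ)| ≤ (∑ j, |κ j|) * (1 + total q) := by
    rw [Finset.sum_mul]
    refine (Finset.abs_sum_le_sum_abs _ _).trans (Finset.sum_le_sum fun j _ => ?_)
    rw [abs_mul, Nat.abs_cast]
    have : (q.2 j : ℝ) ≤ total q := by exact_mod_cast le_total_snd q j
    gcongr
    linarith
  have h2 : |∑ i, κ' i * (q.1 i : ℝ)| ≤ (∑ i, |κ' i|) * (1 + total q) := by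
    rw [Finset.sum_mul]
    refine (Finset.abs_sum_le_sum_abs _ _).trans (Finset.sum_le_sum fun i _ => ?_)
    rw [abs_mul, Nat.abs_cast]
    have : (q.1 i : ℝ) ≤ total q := by exact_mod_cast le_total_fst q i
    gcongr
    linarith
  rw [add_mul]
  exact (abs_sub _ _).trans (add_le_add h1 h2)

theorem abs_cap_mul_op_imbalance_sub_le {a : ArrivalRates n m}
    (hr : r.IsMaxWeight (M.fluidSupport x)) {κ : Fin m → ℝ} {κ' : Fin n → ℝ}
    (hκ : ∀ i j, (i, j) ∈ M.fluidSupport x → κ j = κ' i) (q : QueueState n m) :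
    |(a.cap : ℝ) * ((a.eventChain r).op (imbalance κ κ') q - imbalance κ κ' q)| ≤
      (∑ j, |κ j| + ∑ i, |κ' i|) * a.cap := by
  have hcust : ∀ j, (a.customer q j : ℝ) ≤ a.cap := fun j => by
    have h : a.customer q j ≤ a.cap := (Finset.single_le_sum (f := a.customer q)
      (fun _ _ => zero_le) (Finset.mem_univ j)).trans (le_add_self.trans (a.total_le q))
    exact_mod_cast h
  have hserv : ∀ i, (a.server q i : ℝ) ≤ a.cap := fun i => by
    have h : a.server q i ≤ a.cap := (Finset.single_le_sum (f := a.server q)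
      (fun _ _ => zero_le) (Finset.mem_univ i)).trans (le_self_add.trans (a.total_le q))
    exact_mod_cast h
  rw [ArrivalRates.cap_mul_op_imbalance_sub hr hκ, add_mul, Finset.sum_mul, Finset.sum_mul]
  refine (abs_sub _ _).trans (add_le_add
    ((Finset.abs_sum_le_sum_abs _ _).trans (Finset.sum_le_sum fun j _ => ?_))
    ((Finset.abs_sum_le_sum_abs _ _).trans (Finset.sum_le_sum fun i _ => ?_)))
  · rw [abs_mul, NNReal.abs_eq]
    exact mul_le_mul_of_nonneg_left (hcust j) (abs_nonneg _)
  · rw [abs_mul, NNReal.abs_eq]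
    exact mul_le_mul_of_nonneg_left (hserv i) (abs_nonneg _)

/-- The long-run average profit exists and differs from the scaled fluid optimum by the expansion
error and the holding cost of the mean queue length. -/
theorem exists_profitLoss (hs : 0 ≤ M.s) (hx : M.FluidOptimal x)
    (hr : r.IsMaxWeight (M.fluidSupport x)) {κ : Fin m → ℝ} {κ' : Fin n → ℝ}
    (hκ : ∀ i j, (i, j) ∈ M.fluidSupport x → κ j = κ' i) (hη : 0 < η) {c C p ε : ℝ}
    (hD : ((twoPricePolicy x T₁ θ φ η).eventChain r).Drift (M.matchedStates x) 0 total sumSq c C p)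
    (herr : ∀ q ∈ M.matchedStates x,
      |(M.scaled η).profitRate (twoPricePolicy x T₁ θ φ η) q - (η * M.fluidObjective x +
        (twoPricePolicy x T₁ θ φ η).cap *
          (((twoPricePolicy x T₁ θ φ η).eventChain r).op (imbalance κ κ') q - imbalance κ κ' q)) +
        M.s * total q| ≤ ε) :
    ∃ L, (M.scaled η).HasProfitLoss (twoPricePolicy x T₁ θ φ η) r L ∧
      |L| ≤ ε + M.s * (C / c) := by
  set a := twoPricePolicy x T₁ θ φ η with ha
  set B := (∑ j, |κ j| + ∑ i, |κ' i|) * (a.cap : ℝ) with hB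
  set b := η * M.fluidObjective x with hb
  have hB0 : 0 ≤ B := by positivity
  have hR : ∀ q ∈ M.matchedStates x,
      |(M.scaled η).profitRate a q| ≤ (|b| + B + |ε| + M.s) * (1 + total q) := by
    intro q hq
    have h1 := abs_le.1 (herr q hq)
    have h2 := abs_le.1 (abs_cap_mul_op_imbalance_sub_le (a := a) hr hκ q)
    have h3 := neg_abs_le b
    have h4 := le_abs_self b
    have h5 := le_abs_self ε
    have hN : (0 : ℝ) ≤ total q := Nat.cast_nonneg _
    have h6 : 0 ≤ (|b| + B + |ε|) * total q := by positivity
    have h7 : 0 ≤ M.s * total q := by positivity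
    rw [abs_le]
    constructor <;> linarith [h1.1, h1.2, h2.1, h2.2]
  obtain ⟨g, hg, hgb⟩ := hD.exists_tendsto_reward hs hR (fun q _ => abs_imbalance_le κ κ' q) herr
  obtain ⟨g', hg'⟩ := hD.exists_tendsto (R := fun q => |(M.scaled η).profitRate a q|)
    fun q hq => (abs_abs _).trans_le (hR q hq)
  obtain ⟨B', hB'⟩ := hg'.bddAbove_range
  refine ⟨(M.scaled η).fluidValue - g, ⟨g, ?_, rfl⟩, ?_⟩
  · exact ArrivalRates.hasLongRunAverage_of_tendsto a r (fun k => hB' ⟨k, rfl⟩) hg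
  · rw [fluidValue_scaled hx hη, abs_sub_comm]
    exact hgb

end TwoSidedQueue

theorem mainTheorem2 {n m : ℕ} (M : TwoSidedQueue n m) (hM : M.Regular)
    (x : FluidPoint n m) (hx : M.FluidOptimal x)
    (hlam : ∀ j, x.lam j = 0 ∨ x.lam j ∈ interior (M.domF j))
    (hmu : ∀ i, x.mu i = 0 ∨ x.mu i ∈ interior (M.domG i))
    (T₁ : ℝ) (hT₁ : 0 < T₁)
    (θ : Fin m → ℝ≥0) (hθ : ∀ j, 0 < θ j) (φ : Fin n → ℝ≥0) (hφ : ∀ i, 0 < φ i)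
    (r : ℕ → MatchingRule n m) (hr : ∀ η, (r η).IsMaxWeight (M.fluidSupport x)) :
    ∃ L : ℕ → ℝ,
      (∀ᶠ η : ℕ in atTop,
        TwoPriceUntruncated x T₁ θ φ η (r η) ∧
        (M.scaled η).Admissible (twoPricePolicy x T₁ θ φ η) (r η) ∧
        (twoPricePolicy x T₁ θ φ η).Stable (r η) ∧
        (M.scaled η).HasProfitLoss (twoPricePolicy x T₁ θ φ η) (r η) (L η)) ∧
      L =O[atTop] fun η : ℕ => (η : ℝ) ^ (1 / 3 : ℝ) := by
  choose CF hCF using fun j =>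
    exists_twoPriceRate_expansion (hM.F_smooth j) (hlam j) hT₁ (θ j)
  choose CG hCG using fun i =>
    exists_twoPriceRate_expansion (hM.G_smooth i) (hmu i) hT₁ (φ i)
  obtain ⟨ψ₁, hψ₁, hψθ⟩ := Finite.exists_pos_le fun j => (θ j : ℝ)
  obtain ⟨ψ₂, hψ₂, hψφ⟩ := Finite.exists_pos_le fun i => (φ i : ℝ)
  set ψ := min ψ₁ ψ₂
  have hψ : 0 < ψ := lt_min hψ₁ hψ₂
  set D := ∑ i, x.mu i + ∑ j, x.lam j + (n + m) * (2 * ψ * T₁)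
  have main : ∀ᶠ η : ℕ in atTop, ∃ L : ℝ,
      (TwoPriceUntruncated x T₁ θ φ η (r η) ∧
        (M.scaled η).Admissible (twoPricePolicy x T₁ θ φ η) (r η) ∧
        (twoPricePolicy x T₁ θ φ η).Stable (r η) ∧
        (M.scaled η).HasProfitLoss (twoPricePolicy x T₁ θ φ η) (r η) L) ∧
      |L| ≤ (∑ j, CF j + ∑ i, CG i + M.s * (D / (2 * ψ))) * (η : ℝ) ^ (1 / 3 : ℝ) := by
    filter_upwards [eventually_gt_atTop 0, eventually_all.2 hCF, eventually_all.2 hCG,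
      eventually_all.2 fun j => eventually_twoPriceRate_mem (hM.domF_nonneg j)
        (hx.1.lam_mem j) (hlam j) hT₁ (θ j),
      eventually_all.2 fun i => eventually_twoPriceRate_mem (hM.domG_nonneg i)
        (hx.1.mu_mem i) (hmu i) hT₁ (φ i)] with η hη hF hG hdF hdG
    have hη' : (0 : ℝ) < η := by exact_mod_cast hη
    have hU : TwoSidedQueue.UntruncatedOn x T₁ θ φ η (M.matchedStates x) := fun q hq =>
      ⟨fun j => (hdF j (q.2 j) (hq.2.1 j)).1, fun i => (hdG i (q.1 i) (hq.2.2 i)).1⟩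
    obtain ⟨p, hD⟩ := TwoSidedQueue.exists_drift hx.1 hT₁ (hr η) hψ
      (fun j => (min_le_left _ _).trans (hψθ j (hθ j)))
      (fun i => (min_le_right _ _).trans (hψφ i (hφ i))) hη hU
    have hreach : ∀ q, (twoPricePolicy x T₁ θ φ η).Reachable (r η) q → q ∈ M.matchedStates x :=
      fun q => ArrivalRates.mem_of_reachable hD.closed hD.mem
    have hκ : ∀ i j, (i, j) ∈ M.fluidSupport x →
        deriv (fun y => y * M.F j y) (x.lam j) = deriv (fun y => y * M.G i y) (x.mu i) :=
      fun i j h => hx.deriv_eq hM hlam hmu h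
    obtain ⟨L, hL, hLbd⟩ := TwoSidedQueue.exists_profitLoss hM.s_nonneg hx (hr η) hκ hη hD
      fun q hq =>
        TwoSidedQueue.abs_profitRate_sub_le hx.1 (hr η) hκ hU hF hG hq
    refine ⟨L, ⟨fun q hq => hU q (hreach q hq), fun q hq => ?_,
      ArrivalRates.stable_of_drift hD, hL⟩, hLbd.trans_eq ?_⟩
    · have hq' := hreach q hq
      refine ⟨fun j => ?_, fun i => ?_⟩
      · rw [hU.coe_customer hq']
        exact (hdF j (q.2 j) (hq'.2.1 j)).2
      · rw [hU.coe_server hq']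
        exact (hdG i (q.1 i) (hq'.2.2 i)).2
    · have hcap : ((twoPricePolicy x T₁ θ φ η).cap : ℝ) ≠ 0 := by
        exact_mod_cast (twoPricePolicy x T₁ θ φ η).cap_pos.ne'
      have hz : (η : ℝ) ^ (2 / 3 : ℝ) ≠ 0 := by positivity
      have hratio : η * D / (twoPricePolicy x T₁ θ φ η).cap /
          (2 * ψ * (η : ℝ) ^ (2 / 3 : ℝ) / (twoPricePolicy x T₁ θ φ η).cap) =
          D / (2 * ψ) * (η : ℝ) ^ (1 / 3 : ℝ) := by
        rw [div_div_div_cancel_right₀ hcap, div_mul_eq_mul_div,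
          div_eq_div_iff (by positivity) (by positivity)]
        conv_lhs => rw [← natCast_rpow_mul_rpow_third η]
        ring
      rw [hratio, ← Finset.sum_mul, ← Finset.sum_mul]
      ring
  obtain ⟨L, hL⟩ := main.choice
  refine ⟨L, hL.mono fun η h => h.1, ?_⟩
  refine IsBigO.of_bound (∑ j, CF j + ∑ i, CG i + M.s * (D / (2 * ψ))) (hL.mono fun η h => ?_)
  rw [Real.norm_eq_abs, Real.norm_of_nonneg (by positivity)]
  exact h.2
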